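/- Let $0<q<1$ and let $s_0,s_1,s_2,s_3\in\mathbb C$ satisfy $s_0\neq 0$ and $\chi:=s_0s_1s_2s_3\notin q^{\mathbb Z}$. Write $(x;q)_n=\prod_{k=0}^{n-1}(1-xq^k)$, $(x_1,\dots,x_m;q)_n=\prod_i(x_i;q)_n$, and $1/(q;q)_p:=0$ for $p<0$. Let $\mathrm{Sym}(N)$ and $\mathrm{Sym}$ be the algebras of symmetric polynomials in $N$ variables and of symmetric functions over $\mathbb C$, and let $V(x_1,\dots,x_N)=\prod_{i<j}(x_i-x_j)$. For a partition $\lambda$, let $\ell(\lambda)$ be its number of nonzero parts and $|\lambda|=\lambda_1+\lambda_2+\cdots$; $\mu\subseteq\lambda$ denotes inclusion of Young diagrams. *Convergence.* The projection $F\mapsto F(x_1,\dots,x_N,0,0,\dots)$ restricts, for $N\ge d$, to an isomorphism $\mathrm{Sym}_{\le d}\to\mathrm{Sym}_{\le d}(N)$ of the subspaces of elements of degree at most $d$; let $\iota_{d,N}$ be its inverse. A sequence $F_N\in\mathrm{Sym}(N)$, $N\ge N_0$, *converges* to $F\in\mathrm{Sym}$, written $F_N\to F$, if $\sup_N\deg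 F_N<\infty$ and, for every large enough $d$, $\iota_{d,N}(F_N)\to F$ as $N\to\infty$ in the finite-dimensional space $\mathrm{Sym}_{\le d}$. *$q$-Racah polynomials.* Let $\varphi_n(x;q;s_0,s_1,s_2,s_3)$ be the monic polynomial in $x=v-v^{-1}$ $$\varphi_n=\frac{\prod_{k=1}^3(-s_0s_k;q)_n}{s_0^n(\chi q^{n-1};q)_n}\;{}_4\phi_3\!\left[\begin{matrix}q^{-n},\ \chi q^{n-1},\ s_0v,\ -s_0v^{-1}\\ -s_0s_1,\ -s_0s_2,\ -s_0s_3\end{matrix}\,\Big|\,q,\,q\right],$$ where the denominators $(-s_0s_k;q)_m$, $m\le n$, of the series are cancelled against the prefactor. For $\ell(\lambda)\le N$ put $$\varphi_{\lambda|N}(x_1,\dots,x_N;q;s_0,\dots,s_3)=\frac{\det[\varphi_{\lambda_j+N-j}(x_i;q;s_0,\dots,s_3)]_{i,j=1}^N}{V(x_1,\dots,x_N)},$$ $$\widetilde\varphi_{\lambda|N}(x_1,\dots,x_N)=q^{\frac{N-1}2|\lambda|}\,\varphi_{\lambda|N}\big(x_1q^{\frac{1-N}2},\dots,x_Nq^{\frac{1-N}2};q;s_0q^{\frac{1-N}2},s_1q^{\frac{1-N}2},s_2q^{\frac{1-N}2},s_3q^{\frac{1-N}2}\big).$$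 *Interpolation functions.* For a partition $\mu$ and $N\ge\ell(\mu)$ let $c^{(N)}_i=s_0^{-1}q^{N-1-i}-s_0q^i$ and $$I_{\mu|N}(x_1,\dots,x_N)=\frac{\det\big[\prod_{r=0}^{\mu_i+N-i-1}(x_j-c^{(N)}_r)\big]_{i,j=1}^N}{V(x_1,\dots,x_N)} .$$ **Theorem.** (a) For every partition $\mu$ the sequence $I_{\mu|N}$ converges, in the above sense, to an element $I_\mu\in\mathrm{Sym}$. (b) For partitions $\mu\subseteq\lambda$ let $$\sigma(\lambda,\mu)=s_0^{|\mu|-|\lambda|}\det\left[\frac{(-s_0s_1q^{\mu_k+1-k},-s_0s_2q^{\mu_k+1-k},-s_0s_3q^{\mu_k+1-k};q)_{p_{jk}}}{q^{(\mu_k+1-k)p_{jk}}\,(q,\chi q^{\lambda_j+\mu_k+1-j-k};q)_{p_{jk}}}\right]_{j,k=1}^{\ell(\lambda)},\qquad p_{jk}=\lambda_j-j-\mu_k+k,$$ where entries with $p_{jk}<0$ are $0$ and $\sigma(\emptyset,\emptyset)=1$, and put $\Phi_\lambda=\sum_{\mu\subseteq\lambda}\sigma(\lambda,\mu)\,I_\mu\in\mathrm{Sym}$.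 Then for every partition $\lambda$ $$\widetilde\varphi_{\lambda|N}\to\Phi_\lambda\qquad(N\to\infty,\ N\ge\ell(\lambda)).$$ -/

import Mathlib

open Filter Topology

noncomputable section

namespace QRacah

/-! ### Symmetric polynomials and symmetric functions -/

/-- The algebra `Sym(N)` of symmetric polynomials in `N` variables over `ℂ`. -/
abbrev SymPoly (N : ℕ) : Subalgebra ℂ (MvPolynomial (Fin N) ℂ) :=
  MvPolynomial.symmetricSubalgebra (Fin N) ℂ

/-- The algebra `Sym` of symmetric functions over `ℂ`: formal power series of bounded degree in
countably many variables which are invariant under permutations of the variables. -/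
def Sym : Subalgebra ℂ (MvPowerSeries ℕ ℂ) where
  carrier := {F | (∃ d : ℕ, ∀ m, MvPowerSeries.coeff m F ≠ 0 → m.degree ≤ d) ∧
    ∀ e : Equiv.Perm ℕ, MvPowerSeries.renameEquiv ℂ e F = F}
  mul_mem' := by
    rintro F G ⟨⟨a, ha⟩, hF⟩ ⟨⟨b, hb⟩, hG⟩
    refine ⟨⟨a + b, fun m hm => ?_⟩, fun e => by rw [map_mul, hF e, hG e]⟩
    classical
    rw [MvPowerSeries.coeff_mul] at hm
    obtain ⟨x, hx, hne⟩ := Finset.exists_ne_zero_of_sum_ne_zero hm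
    rw [← Finset.HasAntidiagonal.mem_antidiagonal.1 hx, map_add]
    exact add_le_add (ha _ (left_ne_zero_of_mul hne)) (hb _ (right_ne_zero_of_mul hne))
  add_mem' := by
    rintro F G ⟨⟨a, ha⟩, hF⟩ ⟨⟨b, hb⟩, hG⟩
    refine ⟨⟨max a b, fun m hm => ?_⟩, fun e => by rw [map_add, hF e, hG e]⟩
    by_cases h : MvPowerSeries.coeff m F = 0
    · refine (hb m fun h' => hm ?_).trans (le_max_right _ _)
      rw [map_add, h, h', add_zero]
    · exact (ha m h).trans (le_max_left _ _)
  algebraMap_mem' r := by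
    refine ⟨⟨0, fun m hm => ?_⟩, fun e => AlgEquiv.commutes _ _⟩
    classical
    rw [MvPowerSeries.algebraMap_apply, MvPowerSeries.coeff_C] at hm
    by_contra h
    apply hm
    rw [if_neg]
    rintro rfl
    simp at h

theorem Sym.coeff_perm (F : Sym) (e : Equiv.Perm ℕ) (m : ℕ →₀ ℕ) :
    MvPowerSeries.coeff (m.embDomain e.toEmbedding) (F : MvPowerSeries ℕ ℂ) =
      MvPowerSeries.coeff m (F : MvPowerSeries ℕ ℂ) := by
  conv_lhs => rw [← F.2.2 e]
  exact MvPowerSeries.coeff_embDomain_rename e.toEmbedding _ m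

/-- `Sym_{≤ d}`, the symmetric functions of degree at most `d`. -/
def SymLE (d : ℕ) : Submodule ℂ Sym where
  carrier := {F | ∀ m, MvPowerSeries.coeff m (F : MvPowerSeries ℕ ℂ) ≠ 0 → m.degree ≤ d}
  add_mem' := by
    intro F G hF hG m hm
    by_cases h : MvPowerSeries.coeff m (F : MvPowerSeries ℕ ℂ) = 0
    · refine hG m fun h' => hm ?_
      rw [Subalgebra.coe_add, map_add, h, h', add_zero]
    · exact hF m h
  zero_mem' := fun m hm => absurd (by simp) hm
  smul_mem' := by
    intro c F hF m hm
    refine hF m fun h => hm ?_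
    rw [Subalgebra.coe_smul, map_smul, h, smul_zero]

/-- `Sym_{≤ d}(N)`, the symmetric polynomials in `N` variables of degree at most `d`. -/
def SymPolyLE (d N : ℕ) : Submodule ℂ (SymPoly N) :=
  (MvPolynomial.restrictTotalDegree (Fin N) ℂ d).comap (SymPoly N).val.toLinearMap

theorem mem_SymPolyLE {d N : ℕ} {f : SymPoly N} :
    f ∈ SymPolyLE d N ↔ (f : MvPolynomial (Fin N) ℂ).totalDegree ≤ d :=
  MvPolynomial.mem_restrictTotalDegree _ _ _

/-- The underlying polynomial of `F(x₁, …, x_N, 0, 0, …)`. -/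
def projPoly (N : ℕ) (F : Sym) : MvPolynomial (Fin N) ℂ :=
  ∑ m ∈ (Finsupp.finite_of_degree_le (σ := Fin N) F.2.1.choose).toFinset,
    MvPolynomial.monomial m
      (MvPowerSeries.coeff (m.embDomain Fin.valEmbedding) (F : MvPowerSeries ℕ ℂ))

theorem degree_embDomain {α β : Type*} (e : α ↪ β) (m : α →₀ ℕ) :
    (m.embDomain e).degree = m.degree := by
  simp [Finsupp.degree_apply]

theorem coeff_projPoly (N : ℕ) (F : Sym) (m : Fin N →₀ ℕ) :
    MvPolynomial.coeff m (projPoly N F) =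
      MvPowerSeries.coeff (m.embDomain Fin.valEmbedding) (F : MvPowerSeries ℕ ℂ) := by
  classical
  simp only [projPoly, MvPolynomial.coeff_sum, MvPolynomial.coeff_monomial]
  rw [Finset.sum_ite_eq']
  split_ifs with h
  · rfl
  · by_contra h'
    apply h
    have := F.2.1.choose_spec _ (Ne.symm h')
    rw [degree_embDomain] at this
    simpa using this

/-- A permutation of the first `N` indices, extended to all indices, moves coefficients of the
truncation in the same way. -/
theorem projPoly_isSymmetric (N : ℕ) (F : Sym) : (projPoly N F).IsSymmetric := by
  intro e
  ext m
  obtain ⟨m', rfl⟩ : ∃ m' : Fin N →₀ ℕ, m = m'.mapDomain e :=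
    ⟨m.mapDomain e.symm, by rw [← Finsupp.mapDomain_comp]; simp⟩
  rw [MvPolynomial.coeff_rename_mapDomain _ e.injective, coeff_projPoly, coeff_projPoly]
  let E : Equiv.Perm ℕ := e.extendDomain (Fin.equivSubtype (n := N))
  rw [← Sym.coeff_perm F E]
  congr 1
  rw [Finsupp.embDomain_eq_mapDomain, Finsupp.embDomain_eq_mapDomain,
    Finsupp.embDomain_eq_mapDomain, ← Finsupp.mapDomain_comp, ← Finsupp.mapDomain_comp]
  refine congrArg (fun g => MvPowerSeries.coeff (R := ℂ) (Finsupp.mapDomain g m'))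
    (funext fun i => ?_)
  have := Equiv.Perm.extendDomain_apply_image e (Fin.equivSubtype (n := N)) i
  exact this

/-- The canonical projection `Sym → Sym(N)`, `F ↦ F(x₁, …, x_N, 0, 0, …)`. -/
def proj (N : ℕ) : Sym →ₗ[ℂ] SymPoly N where
  toFun F := ⟨projPoly N F, projPoly_isSymmetric N F⟩
  map_add' F G := by
    apply Subtype.ext
    ext m
    simp [coeff_projPoly]
  map_smul' c F := by
    apply Subtype.ext
    ext m
    simp [coeff_projPoly]

theorem coeff_proj (N : ℕ) (F : Sym) (m : Fin N →₀ ℕ) :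
    MvPolynomial.coeff m (proj N F : MvPolynomial (Fin N) ℂ) =
      MvPowerSeries.coeff (m.embDomain Fin.valEmbedding) (F : MvPowerSeries ℕ ℂ) :=
  coeff_projPoly N F m

theorem proj_mem {d N : ℕ} {F : Sym} (hF : F ∈ SymLE d) : proj N F ∈ SymPolyLE d N := by
  rw [mem_SymPolyLE]
  refine Finset.sup_le fun m hm => ?_
  have h := hF (m.embDomain Fin.valEmbedding)
  rw [← coeff_proj, degree_embDomain] at h
  exact h (MvPolynomial.mem_support_iff.1 hm)

/-- The projection `Sym_{≤ d} → Sym_{≤ d}(N)`. -/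
def projLE (d N : ℕ) : SymLE d →ₗ[ℂ] SymPolyLE d N :=
  (proj N).restrict fun _ hF => proj_mem hF

/-- Every exponent with at most `N` nonzero entries can be moved to the first `N` places. -/
theorem exists_perm (N : ℕ) (m : ℕ →₀ ℕ) (h : m.degree ≤ N) :
    ∃ (n : Fin N →₀ ℕ) (e : Equiv.Perm ℕ),
      (n.embDomain Fin.valEmbedding).embDomain e.toEmbedding = m := by
  classical
  have hc : m.support.card ≤ N := by
    refine le_trans ?_ h
    rw [Finsupp.degree_apply, Finset.card_eq_sum_ones]
    exact Finset.sum_le_sum fun i hi => Nat.one_le_iff_ne_zero.2 (Finsupp.mem_support_iff.1 hi)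
  let g : m.support → ℕ := fun i => (m.support.equivFin i : ℕ)
  have hg : Function.Injective g := fun i j hij => m.support.equivFin.injective (Fin.ext hij)
  obtain ⟨E, hE⟩ := Equiv.Perm.exists_extending_pair g Subtype.val hg Subtype.val_injective
  refine ⟨Finsupp.equivFunOnFinite.symm fun k : Fin N => m (E k), E, ?_⟩
  ext x
  obtain ⟨y, rfl⟩ := E.surjective x
  refine (Finsupp.embDomain_apply_self _ _ y).trans ?_
  by_cases hy : y < N
  · exact Finsupp.embDomain_apply_self Fin.valEmbedding _ (⟨y, hy⟩ : Fin N)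
  · rw [Finsupp.embDomain_of_notMem_range]
    · by_contra h0
      have hs : E y ∈ m.support := Finsupp.mem_support_iff.2 (Ne.symm h0)
      have h1 : y = g ⟨E y, hs⟩ := E.injective (hE ⟨E y, hs⟩).symm
      exact hy (h1 ▸ (Fin.is_lt _).trans_le hc)
    · rintro ⟨z, rfl⟩
      exact hy z.2

/-- Exponents in `N` variables that agree up to a permutation of all variables agree up to a
permutation of the `N` variables. -/
theorem exists_perm_fin (N : ℕ) (n n' : Fin N →₀ ℕ) (e : Equiv.Perm ℕ)
    (h : (n.embDomain Fin.valEmbedding).embDomain e.toEmbedding =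
      n'.embDomain Fin.valEmbedding) :
    ∃ σ : Equiv.Perm (Fin N), n' = n.mapDomain σ := by
  classical
  have hap : ∀ k : ℕ, (n'.embDomain Fin.valEmbedding) (e k) = n.embDomain Fin.valEmbedding k := by
    intro k
    rw [← h]
    exact Finsupp.embDomain_apply_self _ _ k
  have hn : ∀ k : Fin N, n.embDomain Fin.valEmbedding (k : ℕ) = n k :=
    fun k => Finsupp.embDomain_apply_self Fin.valEmbedding n k
  have hn' : ∀ k : Fin N, n'.embDomain Fin.valEmbedding (k : ℕ) = n' k :=
    fun k => Finsupp.embDomain_apply_self Fin.valEmbedding n' k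
  have hlt : ∀ k : n.support, e (k : Fin N) < N := by
    intro k
    by_contra hk
    refine Finsupp.mem_support_iff.1 k.2 ?_
    rw [← hn, ← hap]
    apply Finsupp.embDomain_of_notMem_range
    rintro ⟨z, hz⟩
    exact hk (hz ▸ z.2)
  obtain ⟨σ, hσ⟩ := Equiv.Perm.exists_extending_pair (fun k : n.support => (k : Fin N))
    (fun k => (⟨e (k : Fin N), hlt k⟩ : Fin N)) Subtype.val_injective
    (fun i j hij => Subtype.ext (Fin.ext (e.injective (congrArg Fin.val hij))))
  refine ⟨σ, ?_⟩
  ext y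
  obtain ⟨x, rfl⟩ := σ.surjective y
  rw [Finsupp.mapDomain_apply σ.injective]
  by_cases hx : x ∈ n.support
  · rw [hσ ⟨x, hx⟩, ← hn', ← hn]
    exact hap x
  · rw [Finsupp.notMem_support_iff.1 hx]
    by_contra h0
    obtain ⟨z, hz⟩ := e.surjective (σ x : ℕ)
    have h1 : n.embDomain Fin.valEmbedding z ≠ 0 := by rwa [← hap, hz, hn']
    by_cases hzN : z < N
    · have hzs : (⟨z, hzN⟩ : Fin N) ∈ n.support := by
        rw [Finsupp.mem_support_iff, ← hn]
        exact h1
      have h2 : σ ⟨z, hzN⟩ = σ x := (hσ ⟨_, hzs⟩).trans (Fin.ext hz)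
      exact hx (σ.injective h2 ▸ hzs)
    · apply h1
      apply Finsupp.embDomain_of_notMem_range
      rintro ⟨w, rfl⟩
      exact hzN w.2

theorem projLE_injective {d N : ℕ} (h : d ≤ N) : Function.Injective (projLE d N) := by
  rw [injective_iff_map_eq_zero]
  intro F hF
  apply Subtype.ext
  apply Subtype.ext
  ext m
  by_contra hm
  have hd : m.degree ≤ N := (F.2 m hm).trans h
  obtain ⟨n, e, rfl⟩ := exists_perm N m hd
  apply hm
  rw [Sym.coeff_perm, ← coeff_proj]
  have h0 : proj N (F : Sym) = 0 := congrArg Subtype.val hF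
  rw [h0]
  simp

theorem projLE_surjective {d N : ℕ} (h : d ≤ N) : Function.Surjective (projLE d N) := by
  classical
  intro f
  have key : ∀ m : ℕ →₀ ℕ, m.degree ≤ d → ∃ n : Fin N →₀ ℕ, ∃ e : Equiv.Perm ℕ,
      (n.embDomain Fin.valEmbedding).embDomain e.toEmbedding = m :=
    fun m hm => exists_perm N m (hm.trans h)
  let c : (ℕ →₀ ℕ) → ℂ := fun m =>
    if hm : m.degree ≤ d then
      MvPolynomial.coeff (key m hm).choose (f : SymPoly N).1 else 0
  have hc : ∀ (n : Fin N →₀ ℕ) (e : Equiv.Perm ℕ),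
      c ((n.embDomain Fin.valEmbedding).embDomain e.toEmbedding) =
        MvPolynomial.coeff n (f : SymPoly N).1 := by
    intro n e
    by_cases hm : ((n.embDomain Fin.valEmbedding).embDomain e.toEmbedding).degree ≤ d
    · simp only [c, dif_pos hm]
      obtain ⟨e', he'⟩ := (key _ hm).choose_spec
      have he : (n.embDomain Fin.valEmbedding).embDomain (e.trans e'.symm).toEmbedding =
          (key _ hm).choose.embDomain Fin.valEmbedding := by
        have h3 := congrArg (Finsupp.mapDomain e'.symm) he'
        simp only [Finsupp.embDomain_eq_mapDomain, ← Finsupp.mapDomain_comp] at h3 ⊢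
        have h4 : e'.symm ∘ e'.toEmbedding ∘ (Fin.valEmbedding : Fin N ↪ ℕ) =
            (Fin.valEmbedding : Fin N ↪ ℕ) := by
          funext i
          simp
        rw [h4] at h3
        exact h3.symm
      obtain ⟨σ, hσ⟩ := exists_perm_fin N _ _ _ he
      rw [hσ]
      conv_lhs => rw [← (f : SymPoly N).2 σ]
      exact MvPolynomial.coeff_rename_mapDomain _ σ.injective _ _
    · simp only [c, dif_neg hm]
      by_contra h0
      apply hm
      rw [degree_embDomain, degree_embDomain]
      exact (MvPolynomial.le_totalDegree (MvPolynomial.mem_support_iff.2 (Ne.symm h0))).trans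
        (mem_SymPolyLE.1 f.2)
  have hb : ∀ m, c m ≠ 0 → m.degree ≤ d := by
    intro m hm
    by_contra h'
    exact hm (dif_neg h')
  have hs : ∀ (e : Equiv.Perm ℕ) (m : ℕ →₀ ℕ), c (m.embDomain e.toEmbedding) = c m := by
    intro e m
    by_cases hm : m.degree ≤ d
    · obtain ⟨n, e', rfl⟩ := key m hm
      have : ((n.embDomain Fin.valEmbedding).embDomain e'.toEmbedding).embDomain e.toEmbedding =
          (n.embDomain Fin.valEmbedding).embDomain (e'.trans e).toEmbedding := by
        simp only [Finsupp.embDomain_eq_mapDomain, ← Finsupp.mapDomain_comp]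
        rfl
      rw [this, hc, hc]
    · have hm' : ¬ (m.embDomain e.toEmbedding).degree ≤ d := by rwa [degree_embDomain]
      simp only [c, dif_neg hm, dif_neg hm']
  let F : MvPowerSeries ℕ ℂ := c
  have hF : ∀ m, MvPowerSeries.coeff m F = c m := fun m => rfl
  have hFS : F ∈ Sym := by
    refine ⟨⟨d, fun m hm => hb m hm⟩, fun e => ?_⟩
    ext m
    obtain ⟨m', rfl⟩ : ∃ m' : ℕ →₀ ℕ, m = m'.embDomain e.toEmbedding :=
      ⟨m.embDomain e.symm.toEmbedding, by
        simp only [Finsupp.embDomain_eq_mapDomain, ← Finsupp.mapDomain_comp]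
        simp⟩
    refine (MvPowerSeries.coeff_embDomain_rename e.toEmbedding F m').trans ?_
    rw [hF, hF, hs]
  refine ⟨⟨⟨F, hFS⟩, fun m hm => hb m hm⟩, ?_⟩
  apply Subtype.ext
  apply Subtype.ext
  ext n
  refine (coeff_proj N ⟨F, hFS⟩ n).trans ?_
  have := hc n (Equiv.refl ℕ)
  rw [← this]
  refine (hF _).trans (congrArg c ?_)
  exact (Finsupp.embDomain_eq_mapDomain _ _).trans Finsupp.mapDomain_id |>.symm

/-- For `d ≤ N` the projection `Sym_{≤ d} → Sym_{≤ d}(N)` is a linear isomorphism. -/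
def projEquiv {d N : ℕ} (h : d ≤ N) : SymLE d ≃ₗ[ℂ] SymPolyLE d N :=
  LinearEquiv.ofBijective (projLE d N) ⟨projLE_injective h, projLE_surjective h⟩

open scoped Classical in
/-- The map `ι_{d,N} : Sym_{≤ d}(N) → Sym_{≤ d}` inverse to the projection, for `d ≤ N`.
(It is given the value `0` where it is not defined.) -/
def iota (d N : ℕ) (f : SymPoly N) : Sym :=
  if h : d ≤ N ∧ f ∈ SymPolyLE d N then ((projEquiv h.1).symm ⟨f, h.2⟩ : SymLE d) else 0

/-- A sequence `F_N ∈ Sym(N)`, `N ≥ N₀`, converges to `Φ ∈ Sym`: the degrees of the `F_N` are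
uniformly bounded and, for every large enough `d`, `ι_{d,N}(F_N) → Φ` as `N → ∞` in the
finite-dimensional space `Sym_{≤ d}`. The coefficients are linear functionals which separate the
points of that space, so convergence in it is convergence of all the coefficients. -/
def ConvergesTo (N₀ : ℕ) (F : (N : ℕ) → SymPoly N) (Φ : Sym) : Prop :=
  (∃ D : ℕ, ∀ N ≥ N₀, (F N : MvPolynomial (Fin N) ℂ).totalDegree ≤ D) ∧
  ∃ d₀ : ℕ, ∀ d ≥ d₀, Φ ∈ SymLE d ∧ ∀ m : ℕ →₀ ℕ,
    Tendsto (fun N => MvPowerSeries.coeff m (iota d N (F N) : MvPowerSeries ℕ ℂ)) atTop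
      (𝓝 (MvPowerSeries.coeff m (Φ : MvPowerSeries ℕ ℂ)))

theorem ConvergesTo.unique {N₀ : ℕ} {F : (N : ℕ) → SymPoly N} {Φ Ψ : Sym}
    (h : ConvergesTo N₀ F Φ) (h' : ConvergesTo N₀ F Ψ) : Φ = Ψ := by
  obtain ⟨-, a, ha⟩ := h
  obtain ⟨-, b, hb⟩ := h'
  apply Subtype.ext
  ext m
  exact tendsto_nhds_unique ((ha _ (le_max_left a b)).2 m) ((hb _ (le_max_right a b)).2 m)

open scoped Classical in
/-- The limit of a sequence `F_N ∈ Sym(N)`, `N ≥ N₀` (`0` if there is none). -/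
def limSym (N₀ : ℕ) (F : (N : ℕ) → SymPoly N) : Sym :=
  if h : ∃ Φ, ConvergesTo N₀ F Φ then h.choose else 0

/-! ### Ratios of alternants -/

/-- The polynomial `V(x₁, …, x_N) = ∏_{i < j} (x_i - x_j)`. -/
def vandermonde (N : ℕ) : MvPolynomial (Fin N) ℂ :=
  ∏ i : Fin N, ∏ j ∈ Finset.Ioi i, (MvPolynomial.X i - MvPolynomial.X j)

/-- The alternant `det [p_i(x_j)]`. -/
def alternant (N : ℕ) (p : Fin N → Polynomial ℂ) : MvPolynomial (Fin N) ℂ :=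
  Matrix.det (Matrix.of fun i j : Fin N => Polynomial.aeval (MvPolynomial.X j) (p i))

theorem rename_alternant (N : ℕ) (p : Fin N → Polynomial ℂ) (e : Equiv.Perm (Fin N)) :
    MvPolynomial.rename e (alternant N p) = ((Equiv.Perm.sign e : ℤ) : MvPolynomial (Fin N) ℂ) *
      alternant N p := by
  rw [alternant, ← Matrix.det_permute' e, AlgHom.map_det]
  congr 1
  ext1 i j
  simp only [AlgHom.mapMatrix_apply, Matrix.map_apply, Matrix.of_apply, Matrix.submatrix_apply, id]
  rw [← Polynomial.aeval_algHom_apply, MvPolynomial.rename_X]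

theorem vandermonde_eq (N : ℕ) :
    vandermonde N = alternant N (fun i => (-Polynomial.X) ^ (i : ℕ)) := by
  have h := Matrix.det_vandermonde (fun i : Fin N => -(MvPolynomial.X i : MvPolynomial (Fin N) ℂ))
  rw [alternant, vandermonde, ← Matrix.det_transpose]
  refine Eq.trans ?_ (h.symm.trans ?_)
  · refine Finset.prod_congr rfl fun i _ => Finset.prod_congr rfl fun j _ => ?_
    ring
  · congr 1
    ext1 i j
    simp [Matrix.vandermonde_apply]

theorem vandermonde_ne_zero (N : ℕ) : vandermonde N ≠ 0 := by
  rw [vandermonde, Finset.prod_ne_zero_iff]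
  intro i _
  rw [Finset.prod_ne_zero_iff]
  intro j hj h
  have h1 : i = j := MvPolynomial.X_injective (sub_eq_zero.1 h)
  exact (Finset.mem_Ioi.1 hj).ne h1

/-- The substitution of `x_j` for `x_i`. -/
def substVar {N : ℕ} (i j : Fin N) : MvPolynomial (Fin N) ℂ →ₐ[ℂ] MvPolynomial (Fin N) ℂ :=
  MvPolynomial.rename fun k => if k = i then j else k

theorem X_sub_X_dvd_iff {N : ℕ} (i j : Fin N) (f : MvPolynomial (Fin N) ℂ) :
    (MvPolynomial.X i - MvPolynomial.X j) ∣ f ↔ substVar i j f = 0 := by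
  have h : ∀ f : MvPolynomial (Fin N) ℂ,
      (MvPolynomial.X i - MvPolynomial.X j) ∣ f - substVar i j f := by
    intro f
    induction f using MvPolynomial.induction_on with
    | C a => simp [substVar]
    | add f g hf hg =>
      rw [map_add, add_sub_add_comm]
      exact dvd_add hf hg
    | mul_X f k hf =>
      have hk : (MvPolynomial.X i - MvPolynomial.X j : MvPolynomial (Fin N) ℂ) ∣
          MvPolynomial.X k - substVar i j (MvPolynomial.X k) := by
        rw [substVar, MvPolynomial.rename_X]
        split_ifs with h
        · rw [h]
        · simp
      rw [map_mul]
      have : f * MvPolynomial.X k - substVar i j f * substVar i j (MvPolynomial.X k) =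
          (f - substVar i j f) * MvPolynomial.X k +
            substVar i j f * (MvPolynomial.X k - substVar i j (MvPolynomial.X k)) := by ring
      rw [this]
      exact dvd_add (hf.mul_right _) (hk.mul_left _)
  constructor
  · rintro ⟨g, rfl⟩
    rw [map_mul]
    simp [substVar]
  · intro hf
    have := h f
    rwa [hf, sub_zero] at this

theorem X_sub_X_prime {N : ℕ} {i j : Fin N} (hij : i ≠ j) :
    Prime (MvPolynomial.X i - MvPolynomial.X j : MvPolynomial (Fin N) ℂ) := by
  refine ⟨fun h => hij (MvPolynomial.X_injective (sub_eq_zero.1 h)), fun h => ?_, fun f g h => ?_⟩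
  · have := (X_sub_X_dvd_iff i j 1).1 h.dvd
    simp at this
  · rw [X_sub_X_dvd_iff, map_mul, mul_eq_zero] at h
    rwa [X_sub_X_dvd_iff, X_sub_X_dvd_iff]

theorem vandermonde_dvd (N : ℕ) (p : Fin N → Polynomial ℂ) : vandermonde N ∣ alternant N p := by
  rw [vandermonde, Finset.prod_sigma']
  refine Finset.prod_dvd_of_isRelPrime ?_ ?_
  · rintro ⟨i, j⟩ hx ⟨k, l⟩ hy hne
    have hij : i < j := by simpa using hx
    have hkl : k < l := by simpa using hy
    refine ((X_sub_X_prime hij.ne).irreducible.isRelPrime_iff_not_dvd).2 fun h => hne ?_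
    rw [X_sub_X_dvd_iff, map_sub, sub_eq_zero] at h
    simp only [substVar, MvPolynomial.rename_X] at h
    have h1 := MvPolynomial.X_injective h
    have : i = k ∧ j = l := by
      split_ifs at h1 <;> subst_vars <;> first | exact ⟨rfl, rfl⟩ | (exfalso; omega)
    obtain ⟨rfl, rfl⟩ := this
    rfl
  · rintro ⟨i, j⟩ hx
    have hij : i < j := by simpa using hx
    rw [X_sub_X_dvd_iff, alternant, AlgHom.map_det]
    refine Matrix.det_zero_of_column_eq hij.ne fun k => ?_
    simp only [AlgHom.mapMatrix_apply, Matrix.map_apply, Matrix.of_apply]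
    rw [← Polynomial.aeval_algHom_apply, ← Polynomial.aeval_algHom_apply, substVar,
      MvPolynomial.rename_X, MvPolynomial.rename_X, if_pos rfl, if_neg hij.ne']

theorem exists_altQuot (N : ℕ) (p : Fin N → Polynomial ℂ) :
    ∃! f : SymPoly N, (f : MvPolynomial (Fin N) ℂ) * vandermonde N = alternant N p := by
  obtain ⟨f, hf⟩ := vandermonde_dvd N p
  rw [mul_comm] at hf
  refine ⟨⟨f, fun e => ?_⟩, hf.symm, fun g hg => ?_⟩
  · have h := congrArg (MvPolynomial.rename e) hf
    have hu : ((Equiv.Perm.sign e : ℤ) : MvPolynomial (Fin N) ℂ) ≠ 0 := by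
      rcases Int.units_eq_one_or (Equiv.Perm.sign e) with h | h <;> simp [h]
    rw [map_mul, rename_alternant, vandermonde_eq, rename_alternant, ← vandermonde_eq, hf] at h
    refine mul_right_cancel₀ (mul_ne_zero hu (vandermonde_ne_zero N)) ?_
    rw [← h]
    ring
  · exact Subtype.ext (mul_right_cancel₀ (vandermonde_ne_zero N) (hg.trans hf))

/-- The symmetric polynomial `det [p_i(x_j)] / V(x₁, …, x_N)`. -/
def altQuot (N : ℕ) (p : Fin N → Polynomial ℂ) : SymPoly N :=
  (exists_altQuot N p).choose

theorem altQuot_mul (N : ℕ) (p : Fin N → Polynomial ℂ) :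
    (altQuot N p : MvPolynomial (Fin N) ℂ) * vandermonde N = alternant N p :=
  (exists_altQuot N p).choose_spec.1

/-- For polynomials `p_0, p_1, …` and a partition `lam` with at most `N` rows, the symmetric
polynomial `det [p_{λ_i + N - i}(x_j)] / V(x₁, …, x_N)`, `1 ≤ i, j ≤ N`; it is `0` if `lam` has
more than `N` rows. Rows of a Young diagram are counted from `0`. -/
def altPoly (p : ℕ → Polynomial ℂ) (lam : YoungDiagram) (N : ℕ) : SymPoly N :=
  if lam.colLen 0 ≤ N then altQuot N fun i => p (lam.rowLen i + (N - 1 - i)) else 0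

/-- The substitution `f(x₁, …, x_N) ↦ f(a x₁, …, a x_N)`. -/
def scaleArg {N : ℕ} (a : ℂ) (f : SymPoly N) : SymPoly N :=
  ⟨MvPolynomial.aeval (fun i => MvPolynomial.C a * MvPolynomial.X i)
      (f : MvPolynomial (Fin N) ℂ), by
    intro e
    conv_rhs => rw [← f.2 e]
    rw [MvPolynomial.aeval_rename, ← AlgHom.comp_apply, MvPolynomial.comp_aeval]
    simp [Function.comp_def]⟩

/-! ### Interpolation symmetric functions -/

/-- The Newton polynomial `(x | c₀, c₁, …)^m = (x - c₀) ⋯ (x - c_{m-1})`. -/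
def newton (c : ℕ → ℂ) (m : ℕ) : Polynomial ℂ :=
  ∏ i ∈ Finset.range m, (Polynomial.X - Polynomial.C (c i))

/-- The multiparameter Schur polynomial `s_{μ|N}(x₁, …, x_N | c₀, c₁, …)`. -/
def multiSchur (c : ℕ → ℂ) (mu : YoungDiagram) (N : ℕ) : SymPoly N :=
  altPoly (newton c) mu N

/-- The polynomial `I_{μ|N}(x₁, …, x_N; q; s)`: the multiparameter Schur polynomial with nodes
`c_i = s⁻¹ q^{N-1-i} - s q^i`. -/
def interpPoly (q s : ℂ) (mu : YoungDiagram) (N : ℕ) : SymPoly N :=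
  multiSchur (fun i => s⁻¹ * q ^ ((N : ℤ) - 1 - i) - s * q ^ i) mu N

/-- The interpolation symmetric function `I_μ(·; q; s) = lim_N I_{μ|N}(·; q; s)`. -/
def interpSym (q s : ℂ) (mu : YoungDiagram) : Sym :=
  limSym (mu.colLen 0) (interpPoly q s mu)

/-! ### q-Racah polynomials -/

/-- The q-Pochhammer symbol `(x; q)_n`. -/
def qPoch (q x : ℂ) (n : ℕ) : ℂ := ∏ k ∈ Finset.range n, (1 - x * q ^ k)

/-- The monic univariate q-Racah polynomial `φ_n(x; q; s₀, s₁, s₂, s₃)`. The factors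
`(-s₀ s_k; q)_m` in the denominators of the series `₄φ₃` are cancelled against the prefactor
`∏_k (-s₀ s_k; q)_n`, which leaves `∏_k (-s₀ s_k q^m; q)_{n-m}`, and
`(s₀ v; q)_m (-s₀ v⁻¹; q)_m = ∏_{i < m} (1 - s₀ q^i x - s₀² q^{2i})` for `x = v - v⁻¹`. -/
def qRacah (q : ℂ) (s : Fin 4 → ℂ) (n : ℕ) : Polynomial ℂ :=
  Polynomial.C ((s 0 ^ n * qPoch q (s 0 * s 1 * s 2 * s 3 * q ^ ((n : ℤ) - 1)) n)⁻¹) *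
  ∑ m ∈ Finset.range (n + 1),
    Polynomial.C (qPoch q (q ^ (-(n : ℤ))) m *
        qPoch q (s 0 * s 1 * s 2 * s 3 * q ^ ((n : ℤ) - 1)) m / qPoch q q m * q ^ m *
        (qPoch q (-s 0 * s 1 * q ^ m) (n - m) * qPoch q (-s 0 * s 2 * q ^ m) (n - m) *
          qPoch q (-s 0 * s 3 * q ^ m) (n - m))) *
      ∏ i ∈ Finset.range m,
        (1 - Polynomial.C (s 0 * q ^ i) * Polynomial.X - Polynomial.C (s 0 ^ 2 * q ^ (2 * i)))

/-- The terminating series `₄φ₃(q^{-n}, a₁, a₂, a₃; b₁, b₂, b₃ | q)` with argument `q`. -/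
def phi43 (q : ℂ) (n : ℕ) (a₁ a₂ a₃ b₁ b₂ b₃ : ℂ) : ℂ :=
  ∑ m ∈ Finset.range (n + 1),
    qPoch q (q ^ (-(n : ℤ))) m * qPoch q a₁ m * qPoch q a₂ m * qPoch q a₃ m /
      (qPoch q q m * qPoch q b₁ m * qPoch q b₂ m * qPoch q b₃ m) * q ^ m

theorem qPoch_mul (q x : ℂ) {n m : ℕ} (h : m ≤ n) :
    qPoch q x m * qPoch q (x * q ^ m) (n - m) = qPoch q x n := by
  obtain ⟨k, rfl⟩ := Nat.exists_eq_add_of_le h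
  rw [Nat.add_sub_cancel_left]
  simp only [qPoch, Finset.prod_range_add, mul_assoc, pow_add]

theorem phi43_term_aux {x1 x2 x3 : ℂ} (y1 y2 y3 K C D R : ℂ) {Q P : ℂ} {B : ℂ} (h1 : x1 ≠ 0)
    (h2 : x2 ≠ 0) (h3 : x3 ≠ 0) :
    K⁻¹ * (C * B / D * R * (y1 * y2 * y3) * (P * Q)) =
      x1 * y1 * (x2 * y2) * (x3 * y3) / K * (C * B * P * Q / (D * x1 * x2 * x3) * R) := by
  by_cases hK : K = 0
  · simp [hK]
  by_cases hD : D = 0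
  · simp [hD]
  field_simp

/-- The hypergeometric formula for the q-Racah polynomials, in the variable `x = v - v⁻¹`. -/
theorem qRacah_eval (q : ℂ) (s : Fin 4 → ℂ) (n : ℕ) (v : ℂ) (hv : v ≠ 0)
    (h1 : qPoch q (-s 0 * s 1) n ≠ 0) (h2 : qPoch q (-s 0 * s 2) n ≠ 0)
    (h3 : qPoch q (-s 0 * s 3) n ≠ 0) :
    (qRacah q s n).eval (v - v⁻¹) =
      qPoch q (-s 0 * s 1) n * qPoch q (-s 0 * s 2) n * qPoch q (-s 0 * s 3) n /
        (s 0 ^ n * qPoch q (s 0 * s 1 * s 2 * s 3 * q ^ ((n : ℤ) - 1)) n) *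
      phi43 q n (s 0 * s 1 * s 2 * s 3 * q ^ ((n : ℤ) - 1)) (s 0 * v) (-s 0 * v⁻¹)
        (-s 0 * s 1) (-s 0 * s 2) (-s 0 * s 3) := by
  have hp : ∀ m, ∏ i ∈ Finset.range m,
      (1 - s 0 * q ^ i * (v - v⁻¹) - s 0 ^ 2 * q ^ (2 * i)) =
      qPoch q (s 0 * v) m * qPoch q (-s 0 * v⁻¹) m := by
    intro m
    rw [qPoch, qPoch, ← Finset.prod_mul_distrib]
    refine Finset.prod_congr rfl fun i _ => ?_
    field_simp
    ring
  simp only [qRacah, phi43, Polynomial.eval_mul, Polynomial.eval_C, Polynomial.eval_finsetSum,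
    Polynomial.eval_prod, Polynomial.eval_sub, Polynomial.eval_one, Polynomial.eval_X, hp]
  rw [Finset.mul_sum, Finset.mul_sum]
  refine Finset.sum_congr rfl fun m hm => ?_
  have hmn : m ≤ n := Nat.lt_succ_iff.1 (Finset.mem_range.1 hm)
  have e1 := qPoch_mul q (-s 0 * s 1) hmn
  have e2 := qPoch_mul q (-s 0 * s 2) hmn
  have e3 := qPoch_mul q (-s 0 * s 3) hmn
  generalize qPoch q (-s 0 * s 1 * q ^ m) (n - m) = y1 at *
  generalize qPoch q (-s 0 * s 2 * q ^ m) (n - m) = y2 at *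
  generalize qPoch q (-s 0 * s 3 * q ^ m) (n - m) = y3 at *
  rw [← e1] at h1 ⊢
  rw [← e2] at h2 ⊢
  rw [← e3] at h3 ⊢
  exact phi43_term_aux _ _ _ _ _ _ _ (left_ne_zero_of_mul h1) (left_ne_zero_of_mul h2)
    (left_ne_zero_of_mul h3)

/-- The `N`-variate q-Racah polynomial `φ_{λ|N}(x₁, …, x_N; q; s₀, s₁, s₂, s₃)`. -/
def multiQRacah (q : ℂ) (s : Fin 4 → ℂ) (lam : YoungDiagram) (N : ℕ) : SymPoly N :=
  altPoly (qRacah q s) lam N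

/-- The renormalized polynomial `q^{(N-1)|λ|/2} φ_{λ|N}(x q^{(1-N)/2}; q; s_i q^{(1-N)/2})`. -/
def renormQRacah (q : ℝ) (s : Fin 4 → ℂ) (lam : YoungDiagram) (N : ℕ) : SymPoly N :=
  ((q ^ (((N : ℝ) - 1) / 2 * lam.card) : ℝ) : ℂ) •
    scaleArg ((q ^ ((1 - (N : ℝ)) / 2) : ℝ) : ℂ)
      (multiQRacah q (fun i => s i * ((q ^ ((1 - (N : ℝ)) / 2) : ℝ) : ℂ)) lam N)

/-! ### q-Racah symmetric functions -/

theorem finite_subdiagrams (lam : YoungDiagram) : {mu : YoungDiagram | mu ≤ lam}.Finite := by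
  refine Set.Finite.of_finite_image (f := YoungDiagram.cells)
    (Set.Finite.subset lam.cells.powerset.finite_toSet ?_) ?_
  · rintro _ ⟨mu, hmu, rfl⟩
    exact Finset.mem_coe.2 (Finset.mem_powerset.2 (YoungDiagram.cells_subset_iff.2 hmu))
  · intro a _ b _ h
    exact YoungDiagram.ext h

/-- The coefficient `σ(λ, μ; q; s₀, s₁, s₂, s₃)`. Rows and columns of the matrix are counted from
`0`, so `j` and `k` stand for the usual indices `j + 1` and `k + 1`. An entry with
`p = λ_j - j - μ_k + k < 0` vanishes because `1 / (q; q)_p = 0` for `p < 0`. -/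
def sigmaCoeff (q : ℂ) (s : Fin 4 → ℂ) (lam mu : YoungDiagram) : ℂ :=
  s 0 ^ ((mu.card : ℤ) - lam.card) *
  Matrix.det (Matrix.of fun j k : Fin (lam.colLen 0) =>
    let p : ℤ := lam.rowLen j - j - mu.rowLen k + k
    if p < 0 then 0 else
      (qPoch q (-s 0 * s 1 * q ^ ((mu.rowLen k : ℤ) - k)) p.toNat *
        qPoch q (-s 0 * s 2 * q ^ ((mu.rowLen k : ℤ) - k)) p.toNat *
        qPoch q (-s 0 * s 3 * q ^ ((mu.rowLen k : ℤ) - k)) p.toNat) /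
      (q ^ (((mu.rowLen k : ℤ) - k) * p) * (qPoch q q p.toNat *
        qPoch q (s 0 * s 1 * s 2 * s 3 *
          q ^ ((lam.rowLen j : ℤ) + mu.rowLen k - 1 - j - k)) p.toNat)))

/-- The q-Racah symmetric function `Φ_λ = ∑_{μ ⊆ λ} σ(λ, μ) I_μ(·; q; s₀)`. -/
def qRacahSym (q : ℂ) (s : Fin 4 → ℂ) (lam : YoungDiagram) : Sym :=
  ∑ mu ∈ (finite_subdiagrams lam).toFinset, sigmaCoeff q s lam mu • interpSym q (s 0) mu

end QRacah

end

noncomputable section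

namespace QRacah

/-! ### Expansion of ratios of alternants -/

/-! The limit in (b) rests on an exact identity for each finite `N`. Put `a = q^{(1-N)/2}`. After `x
↦ a x` and `s_i ↦ s_i a`, the `i`-th factor of the `₄φ₃` series becomes a constant times `x -
c_i^{(N)}` (`newton_factor`). Hence the rescaled one-variable polynomial is a unitriangular
combination of Newton polynomials with explicit coefficients `racahCoeff` (`qRacah_expand`).

Cauchy–Binet carries such a triangular relation over to ratios of alternants, with a sum over `μ ⊆
λ`. Unitriangularity cuts the `N × N` minors down to size `ℓ(λ)` (`altPoly_expand`). In these small
determinants `N` cancels from every exponent of `q` and `s₀`. What remains is `σ(λ, μ)` times a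
product of ratios `(q;q)_{λ_i+N-1-i} / (q;q)_{μ_i+N-1-i}` (`det_racahCoeff`), which tends to `1`. So
(b) follows from (a).

For (a) the same expansion is applied to Newton polynomials and powers of `x`, which writes
`I_{μ|N}` through Schur polynomials `s_{ν|N}`, `ν ⊆ μ`. Schur polynomials are stable in `N`
(`killLast_schur`). The coefficients are determinants of fixed size whose entries, up to sign, are
elementary symmetric functions of fixed order in about `N` nodes. Newton's identities reduce these
to power sums, and the binomial theorem reduces power sums to two-sided geometric sums, which
converge (`exists_tendsto_geom_sum₂`).

Convergence in `Sym` is handled coefficient by coefficient (`convergesTo_iff`). -/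

/-- The strictly decreasing sequence `λ_i + N - i` attached to a Young diagram. -/
def shiftedPart (lam : YoungDiagram) (N : ℕ) (i : Fin N) : ℕ := lam.rowLen i + (N - 1 - i)

theorem shiftedPart_strictAnti (lam : YoungDiagram) (N : ℕ) : StrictAnti (shiftedPart lam N) := by
  intro i j hij
  have h1 : (i : ℕ) < j := hij
  have h2 := lam.rowLen_anti i j h1.le
  have h3 := j.2
  simp only [shiftedPart]
  omega

theorem rowLen_eq_zero {mu : YoungDiagram} {i : ℕ} (h : mu.colLen 0 ≤ i) : mu.rowLen i = 0 := by
  by_contra h0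
  have h1 : (i, 0) ∈ mu := YoungDiagram.mem_iff_lt_rowLen.2 (Nat.pos_of_ne_zero h0)
  rw [YoungDiagram.mem_iff_lt_colLen] at h1
  omega

theorem le_iff_rowLen_le {mu lam : YoungDiagram} : mu ≤ lam ↔ ∀ i, mu.rowLen i ≤ lam.rowLen i := by
  constructor
  · intro h i
    by_contra hlt
    have h1 : (i, lam.rowLen i) ∈ mu := YoungDiagram.mem_iff_lt_rowLen.2 (not_le.1 hlt)
    have h2 : (i, lam.rowLen i) ∈ lam := h h1
    exact lt_irrefl _ (YoungDiagram.mem_iff_lt_rowLen.1 h2)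
  · rintro h ⟨i, j⟩ hc
    exact YoungDiagram.mem_iff_lt_rowLen.2
      ((YoungDiagram.mem_iff_lt_rowLen.1 hc).trans_le (h i))

theorem colLen_mono {mu lam : YoungDiagram} (h : mu ≤ lam) : mu.colLen 0 ≤ lam.colLen 0 := by
  by_contra hlt
  have h1 : (lam.colLen 0, 0) ∈ mu := YoungDiagram.mem_iff_lt_colLen.2 (not_le.1 hlt)
  exact lt_irrefl _ (YoungDiagram.mem_iff_lt_colLen.1 (h h1))

theorem shiftedPart_injective {mu nu : YoungDiagram} {N : ℕ} (hmu : mu.colLen 0 ≤ N)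
    (hnu : nu.colLen 0 ≤ N) (h : shiftedPart mu N = shiftedPart nu N) : mu = nu := by
  have key : ∀ i, mu.rowLen i = nu.rowLen i := by
    intro i
    by_cases hi : i < N
    · have := congrFun h ⟨i, hi⟩
      simpa [shiftedPart] using this
    · rw [rowLen_eq_zero (hmu.trans (not_lt.1 hi)), rowLen_eq_zero (hnu.trans (not_lt.1 hi))]
  exact le_antisymm (le_iff_rowLen_le.2 fun i => (key i).le) (le_iff_rowLen_le.2 fun i => (key i).ge)

theorem exists_shiftedPart {N : ℕ} {l : Fin N → ℕ} (hl : StrictAnti l) :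
    ∃ mu : YoungDiagram, mu.colLen 0 ≤ N ∧ shiftedPart mu N = l := by
  -- A strictly decreasing sequence of naturals drops by at least one per step. So `l i - (N - 1 -
  -- i)` is antitone, and with `j = N - 1` its truncated subtraction loses nothing.
  have hle : ∀ i j : Fin N, i ≤ j → (j - i : ℕ) + l j ≤ l i := by
    intro i j hij
    obtain ⟨j, hj⟩ := j
    induction j with
    | zero =>
      have : i = ⟨0, hj⟩ := le_antisymm hij (Fin.mk_le_of_le_val (Nat.zero_le _))
      subst this
      simp
    | succ j ih =>
      rcases hij.eq_or_lt with h | h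
      · subst h
        simp
      · have h1 : (i : ℕ) < j + 1 := h
        have h2 := ih (by omega) (Fin.mk_le_mk.2 (by omega))
        have h3 : l ⟨j + 1, hj⟩ < l ⟨j, by omega⟩ := hl (Fin.mk_lt_mk.2 (by omega))
        simp only at h2 ⊢
        omega
  have hanti : Antitone fun i : Fin N => l i - (N - 1 - i) := by
    intro i j hij
    have h1 := hle i j hij
    have h2 : (i : ℕ) ≤ j := hij
    simp only
    omega
  refine ⟨YoungDiagram.ofRowLens (List.ofFn fun i : Fin N => l i - (N - 1 - i))
    (List.sortedGE_ofFn_iff.2 hanti), ?_, ?_⟩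
  · by_contra h
    have h1 := YoungDiagram.mem_iff_lt_colLen.2 (not_le.1 h)
    rw [YoungDiagram.mem_ofRowLens] at h1
    obtain ⟨h2, -⟩ := h1
    simp at h2
  · ext i
    have h1 := YoungDiagram.rowLen_ofRowLens (hw := List.sortedGE_ofFn_iff.2 hanti)
      ⟨i, by simp⟩
    rw [shiftedPart, h1]
    have h2 := i.2
    have h3 := hle i ⟨N - 1, by omega⟩ (Fin.mk_le_mk.2 (by omega))
    simp only at h3 ⊢
    simp
    omega

/-- Sort the values in decreasing order. This groups the terms of a multilinear expansion by
diagrams. -/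
theorem exists_shiftedPart_comp {N : ℕ} {k : Fin N → ℕ} (hk : Function.Injective k) :
    ∃ (mu : YoungDiagram) (e : Equiv.Perm (Fin N)), mu.colLen 0 ≤ N ∧ shiftedPart mu N ∘ e = k := by
  let e : Equiv.Perm (Fin N) := Fin.revPerm.trans (Tuple.sort k)
  have hmono : StrictMono (k ∘ Tuple.sort k) :=
    (Tuple.monotone_sort k).strictMono_of_injective (hk.comp (Tuple.sort k).injective)
  have hanti : StrictAnti (k ∘ e) := fun i j hij => hmono (Fin.rev_lt_rev.2 hij)
  obtain ⟨mu, h1, h2⟩ := exists_shiftedPart hanti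
  refine ⟨mu, e.symm, h1, ?_⟩
  rw [h2]
  ext i
  simp

/-! ### Cauchy–Binet for alternants and unitriangular minors -/

/-- If a rearrangement of a decreasing sequence is dominated by a decreasing sequence, then so is
the sequence itself. -/
theorem Antitone.le_of_comp_perm_le {N : ℕ} {l n : Fin N → ℕ} (hl : Antitone l) (hn : Antitone n)
    (e : Equiv.Perm (Fin N)) (h : ∀ i, l (e i) ≤ n i) (k : Fin N) : l k ≤ n k := by
  -- Pigeonhole: otherwise `e` would inject the indices `≥ k` into the smaller set of indices `> k`.
  obtain ⟨i, hi, hik⟩ : ∃ i, k ≤ i ∧ e i ≤ k := by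
    by_contra! hcon
    have h1 : (Finset.Ici k).card ≤ (Finset.Ioi k).card :=
      Finset.card_le_card_of_injOn e (fun i hi => by
        simpa using hcon i (by simpa using hi)) e.injective.injOn
    rw [Fin.card_Ici, Fin.card_Ioi] at h1
    have := k.2
    omega
  exact (hl hik).trans ((h i).trans (hn hi))

/-- Multilinearity of the determinant in its rows; `k` selects one summand from each row. -/
theorem alternant_sum (N : ℕ) (f : ℕ → Polynomial ℂ) (a : Fin N → ℕ → ℂ) (S : Finset ℕ) :
    alternant N (fun i => ∑ m ∈ S, Polynomial.C (a i m) * f m) =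
      ∑ k ∈ Fintype.piFinset fun _ : Fin N => S,
        MvPolynomial.C (∏ i, a i (k i)) * alternant N (fun i => f (k i)) := by
  have h := (Matrix.detRowAlternating (n := Fin N)
    (R := MvPolynomial (Fin N) ℂ)).toMultilinearMap.map_sum_finset
    (fun i m => (MvPolynomial.C (a i m) : MvPolynomial (Fin N) ℂ) •
      fun j : Fin N => Polynomial.aeval (MvPolynomial.X j : MvPolynomial (Fin N) ℂ) (f m))
    (fun _ => S)
  refine Eq.trans ?_ (h.trans (Finset.sum_congr rfl fun k _ => ?_))
  · rw [alternant]
    refine congrArg Matrix.det ?_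
    ext1 i j
    simp [Finset.sum_apply, Polynomial.aeval_C, MvPolynomial.algebraMap_eq]
  · rw [MultilinearMap.map_smul_univ, smul_eq_mul, map_prod]
    rfl

theorem alternant_comp_perm (N : ℕ) (p : Fin N → Polynomial ℂ) (e : Equiv.Perm (Fin N)) :
    alternant N (fun i => p (e i)) =
      ((Equiv.Perm.sign e : ℤ) : MvPolynomial (Fin N) ℂ) * alternant N p := by
  rw [alternant, alternant, ← Matrix.det_permute e]
  rfl

theorem alternant_eq_zero {N : ℕ} {p : Fin N → Polynomial ℂ} {i j : Fin N} (hij : i ≠ j)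
    (h : p i = p j) : alternant N p = 0 :=
  Matrix.det_zero_of_row_eq hij (by ext1 k; simp [h])

theorem altPoly_mul_vandermonde (p : ℕ → Polynomial ℂ) {lam : YoungDiagram} {N : ℕ}
    (h : lam.colLen 0 ≤ N) : (altPoly p lam N : MvPolynomial (Fin N) ℂ) * vandermonde N =
      alternant N fun i => p (shiftedPart lam N i) := by
  rw [altPoly, if_pos h, altQuot_mul]
  rfl

/-- The Cauchy–Binet expansion of an alternant of polynomials which are triangular in another
sequence of polynomials. -/
theorem alternant_expand {p f : ℕ → Polynomial ℂ} {A : ℕ → ℕ → ℂ}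
    (hA : ∀ n m, n < m → A n m = 0)
    (hp : ∀ n, p n = ∑ m ∈ Finset.range (n + 1), Polynomial.C (A n m) * f m)
    {lam : YoungDiagram} {N : ℕ} (h : lam.colLen 0 ≤ N) :
    alternant N (fun i => p (shiftedPart lam N i)) =
      ∑ mu ∈ (finite_subdiagrams lam).toFinset,
        MvPolynomial.C (Matrix.det (Matrix.of fun i j : Fin N =>
          A (shiftedPart lam N i) (shiftedPart mu N j))) *
        alternant N (fun i => f (shiftedPart mu N i)) := by
  set M := lam.rowLen 0 + N with hM
  have hlt : ∀ mu ≤ lam, ∀ i, shiftedPart mu N i < M := by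
    intro mu hmu i
    have h1 := le_iff_rowLen_le.1 hmu i
    have h2 := lam.rowLen_anti 0 i (Nat.zero_le _)
    have h3 := i.2
    simp only [shiftedPart]
    omega
  -- Triangularity allows all rows to be summed over one common range, as the multilinear expansion
  -- requires.
  have hp' : ∀ i : Fin N, p (shiftedPart lam N i) = ∑ m ∈ Finset.range M,
      Polynomial.C (A (shiftedPart lam N i) m) * f m := by
    intro i
    rw [hp]
    refine Finset.sum_subset (Finset.range_mono (hlt lam le_rfl i)) fun m _ hm => ?_
    rw [hA _ _ (by simpa using hm), map_zero, zero_mul]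
  simp only [hp']
  rw [alternant_sum]
  -- The sign in the Leibniz formula is absorbed by permuting the rows of the alternant, so the
  -- right side becomes a sum over pairs `(μ, e)`.
  have hdet : ∀ mu : YoungDiagram,
      MvPolynomial.C (Matrix.det (Matrix.of fun i j : Fin N =>
          A (shiftedPart lam N i) (shiftedPart mu N j))) *
        alternant N (fun i => f (shiftedPart mu N i)) =
      ∑ e : Equiv.Perm (Fin N), MvPolynomial.C (∏ i, A (shiftedPart lam N i)
          (shiftedPart mu N (e i))) * alternant N (fun i => f (shiftedPart mu N (e i))) := by
    intro mu
    rw [← Matrix.det_transpose, Matrix.det_apply', map_sum, Finset.sum_mul]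
    refine Finset.sum_congr rfl fun e _ => ?_
    rw [alternant_comp_perm N (fun i => f (shiftedPart mu N i)) e, map_mul]
    simp only [Matrix.transpose_apply, Matrix.of_apply, map_intCast]
    ring
  simp only [hdet]
  rw [← Finset.sum_product']
  symm
  -- A pair `(μ, e)` corresponds to the choice `k = shiftedPart μ ∘ e`; it is recovered from `k`
  -- because a decreasing sequence is determined by its range. Choices not of this form contribute
  -- zero: a repeated value kills the alternant, and a diagram not inside `λ` forces a vanishing
  -- factor `A n m` with `n < m`.
  refine Finset.sum_of_injOn (fun x i => shiftedPart x.1 N (x.2 i)) ?_ ?_ ?_ ?_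
  · rintro ⟨mu, e⟩ hx ⟨nu, e'⟩ hy hxy
    have hmu : mu ≤ lam := by simpa using hx
    have hnu : nu ≤ lam := by simpa using hy
    have hr : shiftedPart mu N = shiftedPart nu N := by
      refine ((shiftedPart_strictAnti mu N).range_inj (shiftedPart_strictAnti nu N)).1 ?_
      rw [← e.surjective.range_comp (shiftedPart mu N),
        ← e'.surjective.range_comp (shiftedPart nu N)]
      exact congrArg Set.range hxy
    obtain rfl := shiftedPart_injective ((colLen_mono hmu).trans h) ((colLen_mono hnu).trans h) hr
    have : e = e' := Equiv.ext fun i =>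
      (shiftedPart_strictAnti mu N).injective (congrFun hxy i)
    rw [this]
  · rintro ⟨mu, e⟩ hx
    have hmu : mu ≤ lam := by simpa using hx
    simpa using fun i => hlt mu hmu (e i)
  · intro k _ hk
    by_cases hinj : Function.Injective k
    · obtain ⟨mu, e, hmu, rfl⟩ := exists_shiftedPart_comp hinj
      suffices h0 : ∏ i, A (shiftedPart lam N i) ((shiftedPart mu N ∘ e) i) = 0 by
        rw [h0, map_zero, zero_mul]
      by_contra h0
      rw [← ne_eq, Finset.prod_ne_zero_iff] at h0
      refine hk ⟨(mu, e), ?_, rfl⟩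
      suffices mu ≤ lam by simpa using this
      refine le_iff_rowLen_le.2 fun i => ?_
      by_cases hi : i < N
      · have := Antitone.le_of_comp_perm_le (shiftedPart_strictAnti mu N).antitone
          (shiftedPart_strictAnti lam N).antitone e
          (fun i => not_lt.1 fun hlt => h0 i (Finset.mem_univ _) (hA _ _ hlt)) ⟨i, hi⟩
        simpa [shiftedPart] using this
      · rw [rowLen_eq_zero (hmu.trans (not_lt.1 hi))]
        exact Nat.zero_le _
    · simp only [Function.Injective, not_forall] at hinj
      obtain ⟨i, j, hij, hne⟩ := hinj
      rw [alternant_eq_zero hne (by rw [hij]), mul_zero]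
  · rintro ⟨mu, e⟩ _
    rfl

/-- The determinant of minors of a unitriangular matrix reduces to the nontrivial rows. -/
theorem det_shiftedPart {A : ℕ → ℕ → ℂ} (hA : ∀ n m, n < m → A n m = 0) (hA1 : ∀ n, A n n = 1)
    {lam mu : YoungDiagram} (hmu : mu ≤ lam) {N : ℕ} (h : lam.colLen 0 ≤ N) :
    Matrix.det (Matrix.of fun i j : Fin N => A (shiftedPart lam N i) (shiftedPart mu N j)) =
      Matrix.det (Matrix.of fun i j : Fin (lam.colLen 0) =>
        A (lam.rowLen i + (N - 1 - i)) (mu.rowLen j + (N - 1 - j))) := by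
  have hz : ∀ i : Fin N, ¬ (i : ℕ) < lam.colLen 0 → shiftedPart lam N i = N - 1 - i ∧
      shiftedPart mu N i = N - 1 - i := fun i hi =>
    ⟨by rw [shiftedPart, rowLen_eq_zero (not_lt.1 hi), zero_add],
      by rw [shiftedPart, rowLen_eq_zero ((colLen_mono hmu).trans (not_lt.1 hi)), zero_add]⟩
  -- From row `ℓ(λ)` on, both shifted parts equal `N - 1 - i`. The lower left block therefore
  -- vanishes and the lower right block is upper unitriangular.
  rw [Matrix.twoBlockTriangular_det _ (fun i : Fin N => (i : ℕ) < lam.colLen 0)]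
  · have h2 : (Matrix.toSquareBlockProp (Matrix.of fun i j : Fin N =>
        A (shiftedPart lam N i) (shiftedPart mu N j))
        (fun i : Fin N => ¬ (i : ℕ) < lam.colLen 0)).det = 1 := by
      rw [Matrix.det_of_isUpperTriangular]
      · refine Finset.prod_eq_one fun i _ => ?_
        simp only [Matrix.toSquareBlockProp_def, Matrix.of_apply, (hz i.1 i.2).1, (hz i.1 i.2).2,
          hA1]
      · intro i j hij
        have hij' : (j : ℕ) < (i : Fin N) := hij
        have := i.1.2
        simp only [Matrix.toSquareBlockProp_def, Matrix.of_apply, (hz i.1 i.2).1, (hz j.1 j.2).2]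
        exact hA _ _ (by omega)
    rw [h2, mul_one]
    let g : Fin (lam.colLen 0) ≃ {i : Fin N // (i : ℕ) < lam.colLen 0} :=
      { toFun := fun i => ⟨⟨i, i.2.trans_le h⟩, i.2⟩
        invFun := fun i => ⟨i.1, i.2⟩
        left_inv := fun _ => rfl
        right_inv := fun _ => rfl }
    rw [← Matrix.det_submatrix_equiv_self g]
    rfl
  · intro i hi j hj
    rw [Matrix.of_apply, (hz i hi).1]
    refine hA _ _ ?_
    have := i.2
    simp only [shiftedPart]
    omega

/-- Cauchy–Binet divided by the Vandermonde. Neither the index set nor the size of the determinants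
depends on `N`, so limits can be taken term by term. -/
theorem altPoly_expand {p f : ℕ → Polynomial ℂ} {A : ℕ → ℕ → ℂ}
    (hA : ∀ n m, n < m → A n m = 0) (hA1 : ∀ n, A n n = 1)
    (hp : ∀ n, p n = ∑ m ∈ Finset.range (n + 1), Polynomial.C (A n m) * f m)
    {lam : YoungDiagram} {N : ℕ} (h : lam.colLen 0 ≤ N) :
    altPoly p lam N = ∑ mu ∈ (finite_subdiagrams lam).toFinset,
      Matrix.det (Matrix.of fun i j : Fin (lam.colLen 0) =>
        A (lam.rowLen i + (N - 1 - i)) (mu.rowLen j + (N - 1 - j))) • altPoly f mu N := by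
  apply Subtype.ext
  refine mul_right_cancel₀ (vandermonde_ne_zero N) ?_
  rw [altPoly_mul_vandermonde p h, alternant_expand hA hp h]
  simp only [AddSubmonoidClass.coe_finsetSum, Subalgebra.coe_smul, Finset.sum_mul]
  refine Finset.sum_congr rfl fun mu hmu => ?_
  have hmu' : mu ≤ lam := by simpa using hmu
  rw [smul_mul_assoc, altPoly_mul_vandermonde f ((colLen_mono hmu').trans h),
    MvPolynomial.smul_eq_C_mul, det_shiftedPart hA hA1 hmu' h]

/-! ### Convergence of sequences of symmetric polynomials -/

/-- The restriction of an exponent to the first `N` variables. -/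
def truncExp (N : ℕ) (m : ℕ →₀ ℕ) : Fin N →₀ ℕ :=
  m.comapDomain (fun i : Fin N => (i : ℕ)) Fin.val_injective.injOn

theorem truncExp_apply (N : ℕ) (m : ℕ →₀ ℕ) (i : Fin N) : truncExp N m i = m i := rfl

theorem embDomain_truncExp {N : ℕ} {m : ℕ →₀ ℕ} (h : ∀ i ∈ m.support, i < N) :
    (truncExp N m).embDomain Fin.valEmbedding = m := by
  ext i
  by_cases hi : i < N
  · exact Finsupp.embDomain_apply_self Fin.valEmbedding _ (⟨i, hi⟩ : Fin N)
  · rw [Finsupp.embDomain_of_notMem_range]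
    · by_contra h0
      exact hi (h i (Finsupp.mem_support_iff.2 (Ne.symm h0)))
    · rintro ⟨z, rfl⟩
      exact hi z.2

theorem eventually_support_lt (m : ℕ →₀ ℕ) : ∀ᶠ N in atTop, ∀ i ∈ m.support, i < N := by
  filter_upwards [eventually_gt_atTop (m.support.sup id)] with N hN i hi
  exact (Finset.le_sup (f := id) hi).trans_lt hN

theorem coeff_iota {d N : ℕ} (h : d ≤ N) {f : SymPoly N} (hf : f ∈ SymPolyLE d N)
    (n : Fin N →₀ ℕ) :
    MvPowerSeries.coeff (n.embDomain Fin.valEmbedding) (iota d N f : MvPowerSeries ℕ ℂ) =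
      MvPolynomial.coeff n (f : MvPolynomial (Fin N) ℂ) := by
  rw [iota, dif_pos ⟨h, hf⟩, ← coeff_proj]
  have h1 := (projEquiv h).apply_symm_apply ⟨f, hf⟩
  exact congrArg (fun g : SymPolyLE d N => MvPolynomial.coeff n (g : SymPoly N).1) h1

theorem eventually_coeff_iota {N₀ D d : ℕ} {F : (N : ℕ) → SymPoly N}
    (hF : ∀ N ≥ N₀, (F N : MvPolynomial (Fin N) ℂ).totalDegree ≤ D) (hd : D ≤ d) (m : ℕ →₀ ℕ) :
    ∀ᶠ N in atTop, MvPowerSeries.coeff m (iota d N (F N) : MvPowerSeries ℕ ℂ) =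
      MvPolynomial.coeff (truncExp N m) (F N : MvPolynomial (Fin N) ℂ) := by
  filter_upwards [eventually_support_lt m, eventually_ge_atTop d, eventually_ge_atTop N₀]
    with N h1 h2 h3
  rw [← coeff_iota h2 (mem_SymPolyLE.2 ((hF N h3).trans hd)), embDomain_truncExp h1]

/-- Once the first `N` variables contain the support of `m`, truncation keeps its degree, so the
coefficient is already zero. This bounds the degree of a limit. -/
theorem tendsto_coeff_eq_zero {N₀ D : ℕ} {F : (N : ℕ) → SymPoly N}
    (hF : ∀ N ≥ N₀, (F N : MvPolynomial (Fin N) ℂ).totalDegree ≤ D) {m : ℕ →₀ ℕ} {c : ℂ}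
    (hc : Tendsto (fun N => MvPolynomial.coeff (truncExp N m) (F N : MvPolynomial (Fin N) ℂ))
      atTop (𝓝 c)) (hm : D < m.degree) : c = 0 := by
  refine tendsto_nhds_unique hc (tendsto_const_nhds.congr' ?_)
  filter_upwards [eventually_support_lt m, eventually_ge_atTop N₀] with N h1 h2
  symm
  by_contra h0
  have h3 := MvPolynomial.le_totalDegree (MvPolynomial.mem_support_iff.2 h0)
  have h4 : (truncExp N m).degree = m.degree := by
    conv_rhs => rw [← embDomain_truncExp h1, degree_embDomain]
  rw [Finsupp.sum, ← Finsupp.degree_apply, h4] at h3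
  exact absurd (h3.trans (hF N h2)) (not_le.2 hm)

/-- For large `N`, `ι_{d,N}` leaves the coefficient at a fixed exponent unchanged, so the choice of
`d` plays no role. -/
theorem convergesTo_iff {N₀ : ℕ} {F : (N : ℕ) → SymPoly N} {Φ : Sym} :
    ConvergesTo N₀ F Φ ↔
      (∃ D : ℕ, ∀ N ≥ N₀, (F N : MvPolynomial (Fin N) ℂ).totalDegree ≤ D) ∧
      ∀ m : ℕ →₀ ℕ, Tendsto
        (fun N => MvPolynomial.coeff (truncExp N m) (F N : MvPolynomial (Fin N) ℂ)) atTop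
        (𝓝 (MvPowerSeries.coeff m (Φ : MvPowerSeries ℕ ℂ))) := by
  constructor
  · rintro ⟨⟨D, hD⟩, d₀, h⟩
    refine ⟨⟨D, hD⟩, fun m => ?_⟩
    exact ((h _ (le_max_left d₀ D)).2 m).congr' (eventually_coeff_iota hD (le_max_right d₀ D) m)
  · rintro ⟨⟨D, hD⟩, h⟩
    refine ⟨⟨D, hD⟩, D, fun d hd => ⟨fun m hm => ?_, fun m => ?_⟩⟩
    · by_contra hlt
      exact hm (tendsto_coeff_eq_zero hD (h m) (hd.trans_lt (not_le.1 hlt)))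
    · exact (h m).congr' ((eventually_coeff_iota hD hd m).mono fun _ h => h.symm)

/-- The coefficient limits assemble to an element of `Sym`: bounded degree survives the limit, and
so does permutation invariance, which `ι_{D,N}(F_N)` has for every `N`. -/
theorem exists_convergesTo {N₀ D : ℕ} {F : (N : ℕ) → SymPoly N}
    (hF : ∀ N ≥ N₀, (F N : MvPolynomial (Fin N) ℂ).totalDegree ≤ D)
    (h : ∀ m : ℕ →₀ ℕ, ∃ c, Tendsto
      (fun N => MvPolynomial.coeff (truncExp N m) (F N : MvPolynomial (Fin N) ℂ)) atTop (𝓝 c)) :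
    ∃ Φ, ConvergesTo N₀ F Φ := by
  choose c hc using h
  have hb : ∀ m, c m ≠ 0 → m.degree ≤ D := fun m hm => by
    by_contra hlt
    exact hm (tendsto_coeff_eq_zero hF (hc m) (not_le.1 hlt))
  have hc' : ∀ m, Tendsto
      (fun N => MvPowerSeries.coeff m (iota D N (F N) : MvPowerSeries ℕ ℂ)) atTop (𝓝 (c m)) :=
    fun m => (hc m).congr' ((eventually_coeff_iota hF le_rfl m).mono fun _ h => h.symm)
  have hs : ∀ (e : Equiv.Perm ℕ) (m : ℕ →₀ ℕ), c (m.embDomain e.toEmbedding) = c m := by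
    intro e m
    refine tendsto_nhds_unique (hc' _) ((hc' m).congr fun N => ?_)
    rw [Sym.coeff_perm]
  let Φ : MvPowerSeries ℕ ℂ := c
  have hΦ : Φ ∈ Sym := by
    refine ⟨⟨D, fun m hm => hb m hm⟩, fun e => ?_⟩
    ext m
    obtain ⟨m', rfl⟩ : ∃ m' : ℕ →₀ ℕ, m = m'.embDomain e.toEmbedding :=
      ⟨m.embDomain e.symm.toEmbedding, by
        simp only [Finsupp.embDomain_eq_mapDomain, ← Finsupp.mapDomain_comp]
        simp⟩
    exact (MvPowerSeries.coeff_embDomain_rename e.toEmbedding Φ m').trans (hs e m').symm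
  exact ⟨⟨Φ, hΦ⟩, convergesTo_iff.2 ⟨⟨D, hF⟩, hc⟩⟩

theorem convergesTo_limSym {N₀ : ℕ} {F : (N : ℕ) → SymPoly N} (h : ∃ Φ, ConvergesTo N₀ F Φ) :
    ConvergesTo N₀ F (limSym N₀ F) := by
  rw [limSym, dif_pos h]
  exact h.choose_spec

/-! ### Schur polynomials -/

/-- The constants `a i` let the Vandermonde, an alternant of the `(-X)^i`, be covered as well. -/
theorem isHomogeneous_alternant (N : ℕ) (a : Fin N → ℂ) (l : Fin N → ℕ) :
    (alternant N fun i => Polynomial.C (a i) * Polynomial.X ^ l i).IsHomogeneous (∑ i, l i) := by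
  rw [alternant, Matrix.det_apply']
  refine MvPolynomial.IsHomogeneous.sum _ _ _ fun e _ => ?_
  rw [← zero_add (∑ i, l i), ← Equiv.sum_comp e l]
  refine MvPolynomial.IsHomogeneous.mul ?_ (MvPolynomial.IsHomogeneous.prod _ _ _ fun i _ => ?_)
  · rw [← map_intCast (MvPolynomial.C : ℂ →+* MvPolynomial (Fin N) ℂ)]
    exact MvPolynomial.isHomogeneous_C _ _
  · simp only [Matrix.of_apply, map_mul, Polynomial.aeval_C, map_pow, Polynomial.aeval_X,
      MvPolynomial.algebraMap_eq]
    exact MvPolynomial.isHomogeneous_C_mul_X_pow _ _ _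

theorem isHomogeneous_vandermonde (N : ℕ) : (vandermonde N).IsHomogeneous (∑ i : Fin N, (i : ℕ)) := by
  have h := isHomogeneous_alternant N (fun i => (-1) ^ (i : ℕ)) (fun i => (i : ℕ))
  rw [vandermonde_eq]
  convert h using 3 with i
  rw [neg_pow]
  simp

theorem sum_rowLen (lam : YoungDiagram) {d : ℕ} (h : lam.colLen 0 ≤ d) :
    ∑ i : Fin d, lam.rowLen i = lam.card := by
  rw [Fin.sum_univ_eq_sum_range, YoungDiagram.card,
    Finset.card_eq_sum_card_fiberwise (f := Prod.fst) (t := Finset.range d)]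
  · exact Finset.sum_congr rfl fun i _ => YoungDiagram.rowLen_eq_card lam
  · rintro ⟨i, j⟩ hc
    have h1 : (i, 0) ∈ lam := lam.up_left_mem le_rfl (Nat.zero_le j) hc
    rw [YoungDiagram.mem_iff_lt_colLen] at h1
    simpa using h1.trans_le h

theorem sum_shiftedPart {lam : YoungDiagram} {N : ℕ} (h : lam.colLen 0 ≤ N) :
    ∑ i, shiftedPart lam N i = lam.card + ∑ i : Fin N, (i : ℕ) := by
  simp only [shiftedPart]
  rw [Finset.sum_add_distrib, sum_rowLen lam h, Fin.sum_univ_eq_sum_range (fun i => N - 1 - i),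
    Finset.sum_range_reflect (fun i => i), Fin.sum_univ_eq_sum_range (fun i => i)]

/-- The Schur polynomials have degree at most `|ν|`. -/
theorem totalDegree_schur_le (nu : YoungDiagram) (N : ℕ) :
    (altPoly (fun n => Polynomial.X ^ n) nu N : MvPolynomial (Fin N) ℂ).totalDegree ≤ nu.card := by
  by_cases h : nu.colLen 0 ≤ N
  · have h1 := altPoly_mul_vandermonde (fun n => Polynomial.X ^ n) h
    have h2 := isHomogeneous_alternant N (fun _ => 1) (shiftedPart nu N)
    simp only [map_one, one_mul] at h2
    rw [← h1] at h2
    by_cases h0 : (altPoly (fun n => Polynomial.X ^ n) nu N : MvPolynomial (Fin N) ℂ) = 0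
    · rw [h0]
      simp
    have h3 := h2.totalDegree (mul_ne_zero h0 (vandermonde_ne_zero N))
    rw [MvPolynomial.totalDegree_mul_of_isDomain h0 (vandermonde_ne_zero N),
      (isHomogeneous_vandermonde N).totalDegree (vandermonde_ne_zero N), sum_shiftedPart h] at h3
    omega
  · rw [altPoly, if_neg h]
    simp

/-- The substitution of `0` for the last variable. -/
def killLast (N : ℕ) : MvPolynomial (Fin (N + 1)) ℂ →ₐ[ℂ] MvPolynomial (Fin N) ℂ :=
  MvPolynomial.killCompl (Fin.castSucc_injective N)

theorem killLast_X_castSucc (N : ℕ) (i : Fin N) :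
    killLast N (MvPolynomial.X i.castSucc) = MvPolynomial.X i := by
  rw [← MvPolynomial.rename_X (Fin.castSucc), killLast, MvPolynomial.killCompl_rename_app]

theorem killLast_X_last (N : ℕ) : killLast N (MvPolynomial.X (Fin.last N)) = 0 := by
  rw [killLast, MvPolynomial.killCompl, MvPolynomial.aeval_X, dif_neg]
  rintro ⟨i, hi⟩
  exact absurd hi (Fin.castSucc_lt_last i).ne

theorem coeff_killLast (N : ℕ) (f : MvPolynomial (Fin (N + 1)) ℂ) (n : Fin N →₀ ℕ) :
    MvPolynomial.coeff n (killLast N f) =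
      MvPolynomial.coeff (n.mapDomain Fin.castSucc) f := by
  classical
  induction f using MvPolynomial.induction_on' with
  | add p q hp hq => rw [map_add, MvPolynomial.coeff_add, MvPolynomial.coeff_add, hp, hq]
  | monomial u a =>
    by_cases hu : ∃ v : Fin N →₀ ℕ, v.mapDomain Fin.castSucc = u
    · obtain ⟨v, rfl⟩ := hu
      rw [killLast, MvPolynomial.killCompl_monomial_mapDomain, MvPolynomial.coeff_monomial,
        MvPolynomial.coeff_monomial]
      simp only [(Finsupp.mapDomain_injective (Fin.castSucc_injective N)).eq_iff]
    · rw [MvPolynomial.coeff_monomial, if_neg fun h => hu ⟨n, h.symm⟩, killLast,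
        MvPolynomial.killCompl_monomial_eq_zero_of_not_subset, MvPolynomial.coeff_zero]
      intro hs
      exact hu ⟨_, Finsupp.mapDomain_comapDomain _ (Fin.castSucc_injective N) _ hs⟩

theorem killLast_vandermonde (N : ℕ) :
    killLast N (vandermonde (N + 1)) = (∏ i, MvPolynomial.X i) * vandermonde N := by
  have hI : ∀ i : Fin N, Finset.Ioi i.castSucc = insert (Fin.last N)
      ((Finset.Ioi i).map Fin.castSuccEmb) := by
    intro i
    ext j
    refine Fin.lastCases ?_ (fun j => ?_) j
    · simp [Fin.castSucc_lt_last]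
    · simpa using fun _ => (Fin.castSucc_lt_last j).le
  have hL : Finset.Ioi (Fin.last N) = ∅ := by
    ext j
    simp [Fin.le_last]
  rw [vandermonde, vandermonde, Fin.prod_univ_castSucc, hL, Finset.prod_empty, mul_one, map_prod,
    ← Finset.prod_mul_distrib]
  refine Finset.prod_congr rfl fun i _ => ?_
  rw [hI, Finset.prod_insert, map_mul, map_sub, killLast_X_castSucc, killLast_X_last, sub_zero,
    Finset.prod_map, map_prod]
  · congr 1
    refine Finset.prod_congr rfl fun j _ => ?_
    rw [map_sub, killLast_X_castSucc, Fin.coe_castSuccEmb, killLast_X_castSucc]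
  · simp

/-- With the last variable set to `0`, the last column is zero except for the `1` in the last row,
whose exponent is `0`. Expanding along it leaves exponents one larger than those for `N`, hence a
factor `x_j` in each column; the Vandermonde acquires the same factor. -/
theorem killLast_alternant {N : ℕ} {nu : YoungDiagram} (h : nu.colLen 0 ≤ N) :
    killLast N (alternant (N + 1) fun i => Polynomial.X ^ shiftedPart nu (N + 1) i) =
      (∏ i, MvPolynomial.X i) * alternant N fun i => Polynomial.X ^ shiftedPart nu N i := by
  have h0 : shiftedPart nu (N + 1) (Fin.last N) = 0 := by
    simp [shiftedPart, rowLen_eq_zero h]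
  have h1 : ∀ i : Fin N, shiftedPart nu (N + 1) i.castSucc = shiftedPart nu N i + 1 := by
    intro i
    have := i.2
    simp only [shiftedPart, Fin.val_castSucc]
    omega
  rw [alternant, AlgHom.map_det, Matrix.det_succ_column _ (Fin.last N), Fin.sum_univ_castSucc,
    Finset.sum_eq_zero, zero_add]
  · simp only [AlgHom.mapMatrix_apply, Matrix.map_apply, Matrix.of_apply, h0, pow_zero, map_one,
      Fin.val_last, Fin.succAbove_last, mul_one]
    rw [← two_mul, pow_mul, neg_one_sq, one_pow, one_mul]
    simp only [alternant]
    rw [← Matrix.det_mul_row]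
    congr 1
    ext1 i j
    simp [killLast_X_castSucc, h1, pow_succ, mul_comm]
  · intro i _
    simp [killLast_X_last, h1]

/-- Stability of the Schur polynomials. -/
theorem killLast_schur {N : ℕ} {nu : YoungDiagram} (h : nu.colLen 0 ≤ N) :
    killLast N (altPoly (fun n => Polynomial.X ^ n) nu (N + 1)) =
      altPoly (fun n => Polynomial.X ^ n) nu N := by
  have h1 := congrArg (killLast N)
    (altPoly_mul_vandermonde (fun n => Polynomial.X ^ n) (h.trans N.le_succ))
  rw [map_mul, killLast_vandermonde, killLast_alternant h,
    ← altPoly_mul_vandermonde (fun n => Polynomial.X ^ n) h] at h1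
  have h2 : (∏ i, MvPolynomial.X i : MvPolynomial (Fin N) ℂ) ≠ 0 :=
    Finset.prod_ne_zero_iff.2 fun i _ => MvPolynomial.X_ne_zero i
  refine mul_right_cancel₀ (mul_ne_zero h2 (vandermonde_ne_zero N)) (h1.trans ?_)
  ring

/-- By stability the coefficient is constant once `N ≥ ℓ(ν)` and the first `N` variables contain the
support of `m`. -/
theorem exists_tendsto_coeff_schur (nu : YoungDiagram) (m : ℕ →₀ ℕ) :
    ∃ c, Tendsto (fun N => MvPolynomial.coeff (truncExp N m)
      (altPoly (fun n => Polynomial.X ^ n) nu N : MvPolynomial (Fin N) ℂ)) atTop (𝓝 c) := by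
  obtain ⟨N₁, hN₁⟩ := eventually_atTop.1
    ((eventually_support_lt m).and (eventually_ge_atTop (nu.colLen 0)))
  have hstep : ∀ N ≥ N₁, MvPolynomial.coeff (truncExp (N + 1) m)
      (altPoly (fun n => Polynomial.X ^ n) nu (N + 1) : MvPolynomial (Fin (N + 1)) ℂ) =
      MvPolynomial.coeff (truncExp N m)
        (altPoly (fun n => Polynomial.X ^ n) nu N : MvPolynomial (Fin N) ℂ) := by
    intro N hN
    rw [← killLast_schur (hN₁ N hN).2, coeff_killLast]
    congr 1
    ext i
    refine Fin.lastCases ?_ (fun j => ?_) i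
    · rw [Finsupp.mapDomain_of_notMem_range]
      · rw [truncExp_apply]
        by_contra h0
        exact lt_irrefl N ((hN₁ N hN).1 N (Finsupp.mem_support_iff.2 h0))
      · rintro ⟨i, hi⟩
        exact absurd hi (Fin.castSucc_lt_last i).ne
    · rw [Finsupp.mapDomain_apply (Fin.castSucc_injective N)]
      rfl
  refine ⟨_, tendsto_const_nhds.congr' (f₁ := fun _ => MvPolynomial.coeff (truncExp N₁ m)
    (altPoly (fun n => Polynomial.X ^ n) nu N₁ : MvPolynomial (Fin N₁) ℂ)) ?_⟩
  filter_upwards [eventually_ge_atTop N₁] with N hN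
  induction N, hN using Nat.le_induction with
  | base => rfl
  | succ N hN ih => rw [ih, hstep N hN]

/-! ### Convergence of the interpolation polynomials -/

theorem natDegree_newton (c : ℕ → ℂ) (n : ℕ) : (newton c n).natDegree = n := by
  rw [newton, Polynomial.natDegree_finsetProd_X_sub_C_eq_card, Finset.card_range]

theorem monic_newton (c : ℕ → ℂ) (n : ℕ) : (newton c n).Monic :=
  Polynomial.monic_prod_X_sub_C _ _

/-- Vieta's formulas. -/
theorem coeff_newton (c : ℕ → ℂ) {n m : ℕ} (h : m ≤ n) :
    (newton c n).coeff m = (-1) ^ (n - m) *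
      MvPolynomial.aeval (fun i : Fin n => c i) (MvPolynomial.esymm (Fin n) ℂ (n - m)) := by
  rw [MvPolynomial.aeval_esymm_eq_multiset_esymm, newton, ← Fin.prod_univ_eq_prod_range
    (fun i => Polynomial.X - Polynomial.C (c i))]
  have h1 := Multiset.prod_X_sub_C_coeff
    (Multiset.map (fun i : Fin n => c i) Finset.univ.val) (k := m) (by simpa using h)
  rw [Multiset.map_map, Multiset.card_map, Finset.card_val, Finset.card_univ,
    Fintype.card_fin] at h1
  exact h1

/-! ### Limits of symmetric functions of the nodes -/

theorem exists_tendsto_pow {q : ℝ} (hq0 : 0 < q) (hq1 : q < 1) (j : ℕ) :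
    ∃ L, Tendsto (fun n : ℕ => ((q : ℂ) ^ j) ^ n) atTop (𝓝 L) := by
  rcases Nat.eq_zero_or_pos j with rfl | hj
  · exact ⟨1, by simp⟩
  · refine ⟨0, tendsto_pow_atTop_nhds_zero_of_norm_lt_one ?_⟩
    rw [norm_pow, Complex.norm_real, Real.norm_of_nonneg hq0.le]
    exact pow_lt_one₀ hq0.le hq1 hj.ne'

/-- For `j ≠ k` the sum is `(q^{jn} - q^{kn}) / (q^j - q^k)`. For `j = k` it is `n q^{j(n-1)}`,
which tends to `0` since `j > 0`; the excluded case `j = k = 0` would give `n`. -/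
theorem exists_tendsto_geom_sum₂ {q : ℝ} (hq0 : 0 < q) (hq1 : q < 1) {j k : ℕ} (h : 0 < j + k) :
    ∃ L, Tendsto (fun n : ℕ => ∑ i ∈ Finset.range n,
      ((q : ℂ) ^ j) ^ i * ((q : ℂ) ^ k) ^ (n - 1 - i)) atTop (𝓝 L) := by
  have hq : (q : ℂ) ≠ 0 := by exact_mod_cast hq0.ne'
  by_cases hjk : (q : ℂ) ^ j = (q : ℂ) ^ k
  · have hj : j = k := by
      have h1 : q ^ j = q ^ k := by exact_mod_cast hjk
      exact (pow_right_strictAnti₀ hq0 hq1).injective h1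
    subst hj
    have hr0 : 0 < q ^ j := pow_pos hq0 j
    have hr1 : q ^ j < 1 := pow_lt_one₀ hq0.le hq1 (by omega)
    have h1 := ((Complex.continuous_ofReal.tendsto _).comp
      (tendsto_self_mul_const_pow_of_lt_one hr0.le hr1)).div_const ((q : ℂ) ^ j)
    refine ⟨_, h1.congr fun n => ?_⟩
    rw [Finset.sum_congr rfl fun i hi => show ((q : ℂ) ^ j) ^ i * ((q : ℂ) ^ j) ^ (n - 1 - i) =
      ((q : ℂ) ^ j) ^ (n - 1) by
        rw [← pow_add]
        congr 1
        have := Finset.mem_range.1 hi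
        omega]
    rcases n with _ | n
    · simp
    · simp only [Function.comp_apply, Finset.sum_const, Finset.card_range, nsmul_eq_mul,
        Nat.add_sub_cancel, Complex.ofReal_mul, Complex.ofReal_pow, Complex.ofReal_natCast]
      rw [pow_succ _ n, ← mul_assoc, mul_div_assoc, div_self (pow_ne_zero _ hq), mul_one]
  · obtain ⟨L, hL⟩ := exists_tendsto_pow hq0 hq1 j
    obtain ⟨L', hL'⟩ := exists_tendsto_pow hq0 hq1 k
    refine ⟨_, ((hL.sub hL').div_const ((q : ℂ) ^ j - (q : ℂ) ^ k)).congr fun n => ?_⟩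
    rw [(Commute.all _ _).geom_sum₂ hjk]

/-- The nodes of the interpolation polynomials. -/
def node (q s : ℂ) (N : ℕ) (i : ℕ) : ℂ := s⁻¹ * q ^ ((N : ℤ) - 1 - i) - s * q ^ i

/-- With `n = N + e` the node is `-s q^i + s⁻¹ q^{-e} q^{n-1-i}`. The binomial theorem turns the
`k`-th power sum into `k + 1` two-sided geometric sums with exponents `j` and `k - j`, not both
zero. -/
theorem exists_tendsto_psum_node {q : ℝ} (hq0 : 0 < q) (hq1 : q < 1) (s : ℂ) {n : ℕ → ℕ} {e : ℤ}
    (hn : ∀ᶠ N in atTop, (n N : ℤ) = N + e) {k : ℕ} (hk : 0 < k) :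
    ∃ L, Tendsto (fun N => MvPolynomial.aeval (fun i : Fin (n N) => node q s N i)
      (MvPolynomial.psum (Fin (n N)) ℂ k)) atTop (𝓝 L) := by
  have hq : (q : ℂ) ≠ 0 := by exact_mod_cast hq0.ne'
  have hnt : Tendsto n atTop atTop := by
    refine tendsto_atTop.2 fun b => ?_
    filter_upwards [hn, eventually_ge_atTop (b + e.natAbs)] with N h1 h2
    omega
  have hg : ∀ j ∈ Finset.range (k + 1), ∃ L, Tendsto (fun n : ℕ => ∑ i ∈ Finset.range n,
      ((q : ℂ) ^ j) ^ i * ((q : ℂ) ^ (k - j)) ^ (n - 1 - i)) atTop (𝓝 L) := fun j hj =>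
    exists_tendsto_geom_sum₂ hq0 hq1 (by have := Finset.mem_range.1 hj; omega)
  choose! L hL using hg
  refine ⟨∑ j ∈ Finset.range (k + 1), (-s) ^ j * (s⁻¹ * (q : ℂ) ^ (-e)) ^ (k - j) *
    (k.choose j : ℂ) * L j, (tendsto_finsetSum _ fun j hj =>
      ((hL j hj).comp hnt).const_mul _).congr' ?_⟩
  filter_upwards [hn] with N hN
  simp only [MvPolynomial.psum, map_sum, map_pow, MvPolynomial.aeval_X]
  rw [Fin.sum_univ_eq_sum_range (fun i => node q s N i ^ k)]
  have hnode : ∀ i ∈ Finset.range (n N), node q s N i ^ k = ∑ j ∈ Finset.range (k + 1),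
      (-s) ^ j * (s⁻¹ * (q : ℂ) ^ (-e)) ^ (k - j) * (k.choose j : ℂ) *
        (((q : ℂ) ^ j) ^ i * ((q : ℂ) ^ (k - j)) ^ (n N - 1 - i)) := by
    intro i hi
    have hi' := Finset.mem_range.1 hi
    have h1 : node q s N i = -s * (q : ℂ) ^ i + s⁻¹ * (q : ℂ) ^ (-e) * (q : ℂ) ^ (n N - 1 - i) := by
      rw [node, mul_assoc s⁻¹, ← zpow_natCast (q : ℂ) (n N - 1 - i), ← zpow_add₀ hq]
      have : (N : ℤ) - 1 - i = -e + ((n N - 1 - i : ℕ) : ℤ) := by omega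
      rw [this]
      ring
    rw [h1, add_pow]
    refine Finset.sum_congr rfl fun j _ => ?_
    rw [mul_pow, mul_pow, pow_right_comm, pow_right_comm (q : ℂ) (n N - 1 - i)]
    ring
  rw [Finset.sum_congr rfl hnode, Finset.sum_comm]
  refine Finset.sum_congr rfl fun j _ => ?_
  rw [Function.comp_apply, Finset.mul_sum]

/-- Newton's identities express `k e_k` through `e_a p_{k-a}` with `a < k`; induction on `k`. -/
theorem exists_tendsto_esymm_node {q : ℝ} (hq0 : 0 < q) (hq1 : q < 1) (s : ℂ) {n : ℕ → ℕ} {e : ℤ}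
    (hn : ∀ᶠ N in atTop, (n N : ℤ) = N + e) (k : ℕ) :
    ∃ L, Tendsto (fun N => MvPolynomial.aeval (fun i : Fin (n N) => node q s N i)
      (MvPolynomial.esymm (Fin (n N)) ℂ k)) atTop (𝓝 L) := by
  induction k using Nat.strong_induction_on with
  | _ k ih =>
    rcases Nat.eq_zero_or_pos k with rfl | hk
    · exact ⟨1, by simp⟩
    choose! L hL using ih
    have hp : ∀ k > 0, ∃ L, Tendsto (fun N => MvPolynomial.aeval
        (fun i : Fin (n N) => node q s N i) (MvPolynomial.psum (Fin (n N)) ℂ k)) atTop (𝓝 L) :=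
      fun k hk => exists_tendsto_psum_node hq0 hq1 s hn hk
    choose! P hP using hp
    have hk' : (k : ℂ) ≠ 0 := by exact_mod_cast hk.ne'
    have hsum := tendsto_finsetSum
      (Finset.filter (fun a => a.1 < k) (Finset.HasAntidiagonal.antidiagonal k)) fun a ha =>
        ((hL a.1 (Finset.mem_filter.1 ha).2).const_mul ((-1) ^ a.1)).mul (hP a.2 (by
          rw [Finset.mem_filter, Finset.HasAntidiagonal.mem_antidiagonal] at ha
          omega))
    refine ⟨_, ((hsum.const_mul ((-1) ^ (k + 1))).const_mul (k : ℂ)⁻¹).congr fun N => ?_⟩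
    have h := congrArg (MvPolynomial.aeval (fun i : Fin (n N) => node q s N i))
      (MvPolynomial.mul_esymm_eq_sum (Fin (n N)) ℂ k)
    rw [map_mul, map_natCast] at h
    rw [eq_comm, ← mul_right_inj' hk', mul_inv_cancel_left₀ hk', h]
    simp

/-! ### Schur expansion of the interpolation polynomials and proof of (a) -/

theorem interpPoly_eq (q s : ℂ) (mu : YoungDiagram) (N : ℕ) :
    interpPoly q s mu N = altPoly (newton (node q s N)) mu N := rfl

theorem newton_expand (c : ℕ → ℂ) (n : ℕ) : newton c n = ∑ m ∈ Finset.range (n + 1),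
    Polynomial.C ((newton c n).coeff m) * Polynomial.X ^ m := by
  conv_lhs => rw [(newton c n).as_sum_range_C_mul_X_pow, natDegree_newton]

/-- The expansion of the multiparameter Schur polynomials in Schur polynomials. -/
theorem interpPoly_expand (q s : ℂ) {mu : YoungDiagram} {N : ℕ} (h : mu.colLen 0 ≤ N) :
    interpPoly q s mu N = ∑ nu ∈ (finite_subdiagrams mu).toFinset,
      Matrix.det (Matrix.of fun i j : Fin (mu.colLen 0) =>
        (newton (node q s N) (mu.rowLen i + (N - 1 - i))).coeff (nu.rowLen j + (N - 1 - j))) •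
      altPoly (fun n => Polynomial.X ^ n) nu N := by
  rw [interpPoly_eq]
  refine altPoly_expand (A := fun n m => (newton (node q s N) n).coeff m) (fun n m hnm => ?_)
    (fun n => ?_) (newton_expand _) h
  · exact Polynomial.coeff_eq_zero_of_natDegree_lt (by rwa [natDegree_newton])
  · have := monic_newton (node q s N) n
    rwa [Polynomial.Monic, Polynomial.leadingCoeff, natDegree_newton] at this

theorem card_mono {mu lam : YoungDiagram} (h : mu ≤ lam) : mu.card ≤ lam.card :=
  Finset.card_le_card (YoungDiagram.cells_subset_iff.2 h)

theorem interpPoly_mem (q s : ℂ) {mu : YoungDiagram} {N : ℕ} (h : mu.colLen 0 ≤ N) :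
    interpPoly q s mu N ∈ SymPolyLE mu.card N := by
  rw [interpPoly_expand q s h]
  refine Submodule.sum_mem _ fun nu hnu => Submodule.smul_mem _ _ ?_
  exact mem_SymPolyLE.2 ((totalDegree_schur_le nu N).trans (card_mono (by simpa using hnu)))

theorem tendsto_det {d : ℕ} {M : ℕ → Matrix (Fin d) (Fin d) ℂ} {L : Matrix (Fin d) (Fin d) ℂ}
    (h : ∀ i j, Tendsto (fun N => M N i j) atTop (𝓝 (L i j))) :
    Tendsto (fun N => (M N).det) atTop (𝓝 L.det) :=
  ((continuous_id.matrix_det).tendsto L).comp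
    (tendsto_pi_nhds.2 fun i => tendsto_pi_nhds.2 fun j => h i j)

/-- Degree and exponent both grow with `N`, but their difference is eventually `a + j - b - i`. The
entry is thus, up to sign, an elementary symmetric function of fixed order in `N + a - 1 - i` nodes,
or eventually zero if the difference is negative. -/
theorem exists_tendsto_coeff_newton {q : ℝ} (hq0 : 0 < q) (hq1 : q < 1) (s : ℂ) (a b i j : ℕ) :
    ∃ L, Tendsto (fun N : ℕ => (newton (node q s N) (a + (N - 1 - i))).coeff (b + (N - 1 - j)))
      atTop (𝓝 L) := by
  by_cases h : b + i ≤ a + j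
  · obtain ⟨L, hL⟩ := exists_tendsto_esymm_node hq0 hq1 s (n := fun N => a + (N - 1 - i))
      (e := (a : ℤ) - 1 - i) (by
        filter_upwards [eventually_gt_atTop i] with N hN
        omega) (a + j - (b + i))
    refine ⟨_, (hL.const_mul ((-1) ^ (a + j - (b + i)))).congr' ?_⟩
    filter_upwards [eventually_gt_atTop (i + j)] with N hN
    have h1 : a + (N - 1 - i) - (b + (N - 1 - j)) = a + j - (b + i) := by omega
    rw [coeff_newton _ (by omega), h1]
  · refine ⟨0, tendsto_const_nhds.congr' ?_⟩
    filter_upwards [eventually_gt_atTop (i + j)] with N hN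
    exact (Polynomial.coeff_eq_zero_of_natDegree_lt (by rw [natDegree_newton]; omega)).symm

theorem coeff_sum_smul {ι : Type*} {N : ℕ} (S : Finset ι) (a : ι → ℂ) (f : ι → SymPoly N)
    (m : Fin N →₀ ℕ) :
    MvPolynomial.coeff m ((∑ x ∈ S, a x • f x : SymPoly N) : MvPolynomial (Fin N) ℂ) =
      ∑ x ∈ S, a x * MvPolynomial.coeff m (f x : MvPolynomial (Fin N) ℂ) := by
  simp [MvPolynomial.coeff_sum]

/-- In the Schur expansion the determinants converge entrywise and the Schur coefficients stabilize.
As the target is defined as the limit, existence of a limit suffices. -/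
theorem convergesTo_interpSym {q : ℝ} (hq0 : 0 < q) (hq1 : q < 1) (s : ℂ) (mu : YoungDiagram) :
    ConvergesTo (mu.colLen 0) (interpPoly q s mu) (interpSym q s mu) := by
  refine convergesTo_limSym (exists_convergesTo (D := mu.card)
    (fun N hN => mem_SymPolyLE.1 (interpPoly_mem _ _ hN)) fun m => ?_)
  choose S hS using fun nu => exists_tendsto_coeff_schur nu m
  have hK : ∀ (nu : YoungDiagram) (i j : Fin (mu.colLen 0)), ∃ L, Tendsto (fun N : ℕ =>
      (newton (node q s N) (mu.rowLen i + (N - 1 - i))).coeff (nu.rowLen j + (N - 1 - j)))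
      atTop (𝓝 L) := fun nu i j => exists_tendsto_coeff_newton hq0 hq1 s _ _ _ _
  choose K hK using hK
  refine ⟨_, (tendsto_finsetSum (finite_subdiagrams mu).toFinset fun nu _ =>
    (tendsto_det (M := fun N => Matrix.of fun i j => (newton (node q s N)
      (mu.rowLen i + (N - 1 - i))).coeff (nu.rowLen j + (N - 1 - j))) (L := Matrix.of (K nu))
      (hK nu)).mul (hS nu)).congr' ?_⟩
  filter_upwards [eventually_ge_atTop (mu.colLen 0)] with N hN
  rw [interpPoly_expand _ _ hN, coeff_sum_smul]

/-! ### Expansion of the renormalized q-Racah polynomials -/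

theorem alternant_C_mul (N : ℕ) (b : Fin N → ℂ) (p : Fin N → Polynomial ℂ) :
    alternant N (fun i => Polynomial.C (b i) * p i) =
      MvPolynomial.C (∏ i, b i) * alternant N p := by
  rw [alternant, alternant, map_prod, ← Matrix.det_mul_column]
  simp [MvPolynomial.algebraMap_eq]

theorem aeval_alternant {N : ℕ} (a : ℂ) (p : Fin N → Polynomial ℂ) :
    MvPolynomial.aeval (fun i => MvPolynomial.C a * MvPolynomial.X i) (alternant N p) =
      alternant N fun i => (p i).comp (Polynomial.C a * Polynomial.X) := by
  rw [alternant, alternant, AlgHom.map_det]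
  congr 1
  ext1 i j
  simp only [AlgHom.mapMatrix_apply, Matrix.map_apply, Matrix.of_apply]
  rw [← Polynomial.aeval_algHom_apply, MvPolynomial.aeval_X, Polynomial.aeval_comp]
  simp [MvPolynomial.algebraMap_eq]

theorem aeval_vandermonde (N : ℕ) (a : ℂ) :
    MvPolynomial.aeval (fun i => MvPolynomial.C a * MvPolynomial.X i) (vandermonde N) =
      MvPolynomial.C (a ^ ∑ i : Fin N, (i : ℕ)) * vandermonde N := by
  rw [vandermonde_eq, aeval_alternant, ← Finset.prod_pow_eq_pow_sum, ← alternant_C_mul]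
  congr 1
  ext1 i
  simp only [Polynomial.pow_comp, Polynomial.neg_comp, Polynomial.X_comp, map_pow]
  rw [← mul_pow, mul_neg]

/-- Rescaling the variables of a ratio of alternants. -/
theorem smul_scaleArg_altPoly {a : ℂ} (ha : a ≠ 0) (p : ℕ → Polynomial ℂ) {lam : YoungDiagram}
    {N : ℕ} (h : lam.colLen 0 ≤ N) :
    a⁻¹ ^ lam.card • scaleArg a (altPoly p lam N) =
      altPoly (fun n => Polynomial.C (a⁻¹ ^ n) * (p n).comp (Polynomial.C a * Polynomial.X))
        lam N := by
  apply Subtype.ext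
  refine mul_right_cancel₀ (vandermonde_ne_zero N) ?_
  rw [altPoly_mul_vandermonde _ h, alternant_C_mul, Finset.prod_pow_eq_pow_sum, sum_shiftedPart h,
    ← aeval_alternant a (fun i => p (shiftedPart lam N i)), ← altPoly_mul_vandermonde p h, map_mul,
    aeval_vandermonde, Subalgebra.coe_smul, MvPolynomial.smul_eq_C_mul, scaleArg, pow_add, map_mul]
  -- The row factors multiply to `a⁻¹` to the power `|λ| + deg V`; the second part cancels the
  -- factor that `V` acquires under scaling.
  have h1 : (MvPolynomial.C (a⁻¹ ^ ∑ i : Fin N, (i : ℕ)) : MvPolynomial (Fin N) ℂ) *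
      MvPolynomial.C (a ^ ∑ i : Fin N, (i : ℕ)) = 1 := by
    rw [← map_mul, ← mul_pow, inv_mul_cancel₀ ha, one_pow, map_one]
  linear_combination (-1 : MvPolynomial (Fin N) ℂ) * (MvPolynomial.C (a⁻¹ ^ lam.card) *
    MvPolynomial.aeval (fun i => MvPolynomial.C a * MvPolynomial.X i)
      (altPoly p lam N : MvPolynomial (Fin N) ℂ) * vandermonde N) * h1

/-- The coefficients of the expansion of the renormalized q-Racah polynomials in one variable in
the Newton polynomials. -/
def racahCoeff (q : ℂ) (s : Fin 4 → ℂ) (N n m : ℕ) : ℂ :=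
  if m ≤ n then
    qPoch q q n / qPoch q q m * (s 0 ^ (n - m))⁻¹ *
      ((qPoch q (-s 0 * s 1 * q ^ ((m : ℤ) + 1 - N)) (n - m) *
        qPoch q (-s 0 * s 2 * q ^ ((m : ℤ) + 1 - N)) (n - m) *
        qPoch q (-s 0 * s 3 * q ^ ((m : ℤ) + 1 - N)) (n - m)) /
      (q ^ (((m : ℤ) + 1 - N) * ((n : ℤ) - m)) * (qPoch q q (n - m) *
        qPoch q (s 0 * s 1 * s 2 * s 3 * q ^ ((n : ℤ) + m + 1 - 2 * N)) (n - m))))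
  else 0

theorem qPoch_self_ne_zero {q : ℝ} (hq0 : 0 < q) (hq1 : q < 1) (n : ℕ) : qPoch q q n ≠ 0 := by
  rw [qPoch, Finset.prod_ne_zero_iff]
  intro k _ h
  have h1 : q * q ^ k = 1 := by exact_mod_cast (sub_eq_zero.1 h).symm
  rw [← pow_succ'] at h1
  exact (pow_lt_one₀ hq0.le hq1 (Nat.succ_ne_zero k)).ne h1

/-- Applied to `x = χ`, this keeps the denominators nonzero; the shift `z` is an integer because the
exponents involve `-2N`. -/
theorem qPoch_mul_zpow_ne_zero {q x : ℂ} (hq : q ≠ 0) (hx : ∀ k : ℤ, x ≠ q ^ k) (z : ℤ) (n : ℕ) :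
    qPoch q (x * q ^ z) n ≠ 0 := by
  rw [qPoch, Finset.prod_ne_zero_iff]
  intro k _ h
  refine hx (-(z + k)) ?_
  rw [zpow_neg, zpow_add₀ hq, zpow_natCast]
  exact eq_inv_of_mul_eq_one_left (by linear_combination -h)

theorem qPoch_succ (q x : ℂ) (n : ℕ) : qPoch q x (n + 1) = qPoch q x n * (1 - x * q ^ n) := by
  rw [qPoch, qPoch, Finset.prod_range_succ]

/-- The reflection of the factor `(q^{-n}; q)_m`, together with the leading coefficients of the
factors of the series. -/
theorem qPoch_neg_mul (q : ℂ) (hq : q ≠ 0) (x : ℂ) (m p : ℕ) :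
    qPoch q (q ^ (-((m + p : ℕ) : ℤ))) m * qPoch q q p * q ^ m *
        ∏ i ∈ Finset.range m, (-(x * q ^ i)) =
      qPoch q q (m + p) * (x ^ m * q ^ (-(m * p : ℤ))) := by
  induction m generalizing p with
  | zero => simp [qPoch]
  | succ m ih =>
    -- The total `m + p`, and with it the base `q^{-(m+p)}`, must stay fixed while `m` grows, so the
    -- hypothesis is used at `p + 1`. The new factor `1 - q^{-(p+1)}` is then turned into `1 -
    -- q^{p+1}` by `e5`.
    have h1 := ih (p + 1)
    have e1 : m + 1 + p = m + (p + 1) := by ring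
    rw [e1, qPoch_succ, Finset.prod_range_succ]
    rw [qPoch_succ q q p] at h1
    have e2 : q ^ (-((m + (p + 1) : ℕ) : ℤ)) * q ^ m = (q * q ^ p)⁻¹ := by
      rw [← zpow_natCast q m, ← zpow_add₀ hq, ← pow_succ', ← zpow_natCast q (p + 1), ← zpow_neg]
      congr 1
      push_cast
      ring
    have e3 : q ^ (-(((m + 1 : ℕ) : ℤ) * p)) = q ^ m * q ^ (-((m : ℤ) * ((p + 1 : ℕ) : ℤ))) *
        (q ^ p)⁻¹ := by
      rw [← zpow_natCast q m, ← zpow_add₀ hq, ← zpow_natCast q p, ← zpow_neg, ← zpow_add₀ hq]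
      congr 1
      push_cast
      ring
    have hqp : q ^ p ≠ 0 := pow_ne_zero _ hq
    rw [e2, e3]
    have e4 : (1 - (q * q ^ p)⁻¹) * (q * q ^ p) = -(1 - q * q ^ p) := by
      field_simp
      ring
    have e5 : (1 - (q * q ^ p)⁻¹) * q = -(1 - q * q ^ p) * (q ^ p)⁻¹ := by
      rw [← e4]
      field_simp
    linear_combination (x * q ^ m * (q ^ p)⁻¹) * h1 - (qPoch q (q ^ (-((m + (p + 1) : ℕ) : ℤ))) m *
      qPoch q q p * q ^ m * (∏ i ∈ Finset.range m, (-(x * q ^ i))) * x * q ^ m) * e5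

theorem racahCoeff_eq_zero (q : ℂ) (s : Fin 4 → ℂ) (N : ℕ) {n m : ℕ} (h : n < m) :
    racahCoeff q s N n m = 0 := if_neg (not_le.2 h)

theorem racahCoeff_self {q : ℝ} (hq0 : 0 < q) (hq1 : q < 1) (s : Fin 4 → ℂ) (N n : ℕ) :
    racahCoeff q s N n n = 1 := by
  rw [racahCoeff, if_pos le_rfl, div_self (qPoch_self_ne_zero hq0 hq1 n)]
  simp [qPoch]

/-- This is where the nodes come from: the `i`-th rescaled factor has leading coefficient `-s a²
q^i` and root `s⁻¹ a⁻² q^{-i} - s q^i`, with `a⁻² = q^{N-1}`. -/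
theorem newton_factor {q a s : ℂ} (hq : q ≠ 0) (hs : s ≠ 0) {N : ℕ}
    (ha2 : a ^ 2 = q ^ (1 - (N : ℤ))) (m : ℕ) :
    (∏ i ∈ Finset.range m, (1 - Polynomial.C (s * a * q ^ i) * Polynomial.X -
        Polynomial.C ((s * a) ^ 2 * q ^ (2 * i)))).comp (Polynomial.C a * Polynomial.X) =
      Polynomial.C (∏ i ∈ Finset.range m, (-(s * a ^ 2 * q ^ i))) * newton (node q s N) m := by
  rw [Polynomial.prod_comp, newton, map_prod, ← Finset.prod_mul_distrib]
  refine Finset.prod_congr rfl fun i _ => ?_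
  have h1 : a ^ 2 * q ^ ((N : ℤ) - 1 - i) * q ^ i = 1 := by
    rw [ha2, ← zpow_natCast q i, ← zpow_add₀ hq, ← zpow_add₀ hq,
      show 1 - (N : ℤ) + (N - 1 - i) + i = 0 by ring, zpow_zero]
  have h2 : s * s⁻¹ = 1 := mul_inv_cancel₀ hs
  have h3 : 1 - (s * a) ^ 2 * q ^ (2 * i) = s * a ^ 2 * q ^ i * node q s N i := by
    rw [node]
    linear_combination (-1) * h1 - (a ^ 2 * q ^ ((N : ℤ) - 1 - i) * q ^ i) * h2
  have h4 := congrArg (Polynomial.C : ℂ → Polynomial ℂ) h3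
  simp only [Polynomial.sub_comp, Polynomial.mul_comp, Polynomial.one_comp, Polynomial.C_comp,
    Polynomial.X_comp]
  simp only [map_sub, map_mul, map_pow, map_one, map_neg] at h4 ⊢
  linear_combination h4

/-- Scalar bookkeeping for one term, `n = m + p`: `x0` is `(q^{-n};q)_m`, the `Q`'s are `(q;q)` at
`p`, `m`, `n`, `Km * Kp` is the `χ`-symbol split at `m`, `E = q^m`, `Z = q^{-mp}`, `B1` is the
numerator product and `W` the product of leading coefficients. -/
theorem qRacah_coeff_aux {x0 s0 a K Qp Qm Qn E Km Kp B1 Z : ℂ} {m p : ℕ} (hs0 : s0 ≠ 0) (ha : a ≠ 0)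
    (hKm : Km ≠ 0) (hKp : Kp ≠ 0) (hQp : Qp ≠ 0) (hK : Km * Kp = K) {W : ℂ}
    (hW : x0 * Qp * E * W = Qn * ((s0 * a ^ 2) ^ m * Z)) (hQm : Qm ≠ 0) :
    a⁻¹ ^ (m + p) * (((s0 * a) ^ (m + p) * K)⁻¹ * (x0 * Km / Qm * E * B1)) * W =
      Qn / Qm * (s0 ^ p)⁻¹ * (B1 / ((a ^ 2) ^ p * Z⁻¹ * (Qp * Kp))) := by
  subst hK
  have hx : x0 * E * W = Qn * ((s0 * a ^ 2) ^ m * Z) / Qp := by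
    rw [eq_div_iff hQp, ← hW]
    ring
  have h1 : a⁻¹ ^ (m + p) * (((s0 * a) ^ (m + p) * (Km * Kp))⁻¹ * (x0 * Km / Qm * E * B1)) * W =
      a⁻¹ ^ (m + p) * (((s0 * a) ^ (m + p) * (Km * Kp))⁻¹ * (Km / Qm * B1)) * (x0 * E * W) := by
    ring
  rw [h1, hx, inv_pow]
  -- Here both sides vanish because division by zero gives `0`.
  by_cases hZ : Z = 0
  · simp [hZ]
  field_simp
  ring

/-- The one-variable expansion. -/
theorem qRacah_expand {q : ℝ} (hq0 : 0 < q) (hq1 : q < 1) {s : Fin 4 → ℂ} (hs0 : s 0 ≠ 0)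
    (hs : ∀ k : ℤ, s 0 * s 1 * s 2 * s 3 ≠ (q : ℂ) ^ k) {a : ℂ} (ha : a ≠ 0) {N : ℕ}
    (ha2 : a ^ 2 = (q : ℂ) ^ (1 - (N : ℤ))) (n : ℕ) :
    Polynomial.C (a⁻¹ ^ n) *
        (qRacah q (fun i => s i * a) n).comp (Polynomial.C a * Polynomial.X) =
      ∑ m ∈ Finset.range (n + 1),
        Polynomial.C (racahCoeff q s N n m) * newton (node q (s 0) N) m := by
  have hq : (q : ℂ) ≠ 0 := by exact_mod_cast hq0.ne'
  -- Four rescaled parameters contribute `a⁴ = q^{2-2N}`; in `hparam` two of them contribute `a² =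
  -- q^{1-N}`.
  have hchi : s 0 * a * (s 1 * a) * (s 2 * a) * (s 3 * a) * (q : ℂ) ^ ((n : ℤ) - 1) =
      s 0 * s 1 * s 2 * s 3 * (q : ℂ) ^ ((n : ℤ) + 1 - 2 * N) := by
    have h1 : (n : ℤ) + 1 - 2 * N = (1 - (N : ℤ)) + (1 - (N : ℤ)) + ((n : ℤ) - 1) := by ring
    rw [h1, zpow_add₀ hq, zpow_add₀ hq, ← ha2]
    ring
  have hparam : ∀ (t : ℂ) (m : ℕ), -(s 0 * a) * (t * a) * (q : ℂ) ^ m =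
      -s 0 * t * (q : ℂ) ^ ((m : ℤ) + 1 - N) := by
    intro t m
    have h1 : (m : ℤ) + 1 - N = (1 - (N : ℤ)) + m := by ring
    rw [h1, zpow_add₀ hq, ← ha2, zpow_natCast]
    ring
  simp only [qRacah, hchi, hparam]
  rw [Polynomial.mul_comp, Polynomial.C_comp, Polynomial.sum_comp, ← mul_assoc, ← map_mul,
    Finset.mul_sum]
  refine Finset.sum_congr rfl fun m hm => ?_
  rw [Polynomial.mul_comp, Polynomial.C_comp, newton_factor hq hs0 ha2, ← mul_assoc, ← mul_assoc,
    ← map_mul, ← map_mul]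
  congr 2
  have hmn : m ≤ n := Nat.lt_succ_iff.1 (Finset.mem_range.1 hm)
  rw [racahCoeff, if_pos hmn]
  obtain ⟨p, rfl⟩ := Nat.exists_eq_add_of_le hmn
  rw [Nat.add_sub_cancel_left]
  -- The first `m` factors of the normalizing symbol cancel the numerator `(χ q^{n+1-2N};q)_m` of
  -- the series; the other `p` form the denominator in `racahCoeff`.
  have hK := qPoch_mul q (s 0 * s 1 * s 2 * s 3 * (q : ℂ) ^ (((m + p : ℕ) : ℤ) + 1 - 2 * N)) hmn
  have hKp : s 0 * s 1 * s 2 * s 3 * (q : ℂ) ^ (((m + p : ℕ) : ℤ) + 1 - 2 * N) * (q : ℂ) ^ m =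
      s 0 * s 1 * s 2 * s 3 * (q : ℂ) ^ (((m + p : ℕ) : ℤ) + m + 1 - 2 * N) := by
    rw [mul_assoc _ _ ((q : ℂ) ^ m), ← zpow_natCast (q : ℂ) m, ← zpow_add₀ hq]
    congr 2
    ring
  rw [hKp, Nat.add_sub_cancel_left] at hK
  have hZ : (q : ℂ) ^ (((m : ℤ) + 1 - N) * (((m + p : ℕ) : ℤ) - m)) =
      (a ^ 2) ^ p * ((q : ℂ) ^ (-(m * p : ℤ)))⁻¹ := by
    rw [ha2, ← zpow_natCast _ p, ← zpow_mul, ← zpow_neg, ← zpow_add₀ hq]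
    congr 1
    push_cast
    ring
  rw [hZ, mul_assoc (a⁻¹ ^ (m + p))]
  exact qRacah_coeff_aux hs0 ha (qPoch_mul_zpow_ne_zero hq hs _ _)
    (qPoch_mul_zpow_ne_zero hq hs _ _) (qPoch_self_ne_zero hq0 hq1 p) hK
    (qPoch_neg_mul (q : ℂ) hq (s 0 * a ^ 2) m p) (qPoch_self_ne_zero hq0 hq1 m)

/-- The multivariate expansion. -/
theorem renormQRacah_expand {q : ℝ} (hq0 : 0 < q) (hq1 : q < 1) {s : Fin 4 → ℂ} (hs0 : s 0 ≠ 0)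
    (hs : ∀ k : ℤ, s 0 * s 1 * s 2 * s 3 ≠ (q : ℂ) ^ k) {lam : YoungDiagram} {N : ℕ}
    (h : lam.colLen 0 ≤ N) :
    renormQRacah q s lam N = ∑ mu ∈ (finite_subdiagrams lam).toFinset,
      Matrix.det (Matrix.of fun i j : Fin (lam.colLen 0) => racahCoeff q s N
        (lam.rowLen i + (N - 1 - i)) (mu.rowLen j + (N - 1 - j))) •
      interpPoly q (s 0) mu N := by
  set a : ℂ := ((q ^ ((1 - (N : ℝ)) / 2) : ℝ) : ℂ) with ha_def
  have ha : a ≠ 0 := by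
    rw [ha_def, Complex.ofReal_ne_zero]
    exact (Real.rpow_pos_of_pos hq0 _).ne'
  have ha2 : a ^ 2 = (q : ℂ) ^ (1 - (N : ℤ)) := by
    have h1 : (q ^ ((1 - (N : ℝ)) / 2)) ^ 2 = q ^ (1 - (N : ℤ)) := by
      rw [← Real.rpow_natCast, ← Real.rpow_mul hq0.le, ← Real.rpow_intCast]
      congr 1
      push_cast
      ring
    rw [ha_def]
    exact_mod_cast h1
  have hpre : ((q ^ (((N : ℝ) - 1) / 2 * lam.card) : ℝ) : ℂ) = a⁻¹ ^ lam.card := by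
    have h1 : q ^ (((N : ℝ) - 1) / 2 * lam.card) = (q ^ ((1 - (N : ℝ)) / 2))⁻¹ ^ lam.card := by
      rw [← Real.rpow_neg hq0.le, ← Real.rpow_natCast, ← Real.rpow_mul hq0.le]
      congr 1
      ring
    rw [h1, ha_def]
    push_cast
    rfl
  rw [renormQRacah, hpre, multiQRacah, smul_scaleArg_altPoly ha _ h]
  exact altPoly_expand (fun n m => racahCoeff_eq_zero q s N) (racahCoeff_self hq0 hq1 s N)
    (qRacah_expand hq0 hq1 hs0 hs ha ha2) h

/-! ### Removing `N` from the coefficients and proof of (b) -/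

/-- The determinants in the expansion agree with `σ(λ, μ)` up to a factor. -/
theorem det_racahCoeff {q : ℝ} (s : Fin 4 → ℂ) (hs0 : s 0 ≠ 0) {lam mu : YoungDiagram}
    (hmu : mu ≤ lam) {N : ℕ} (h : lam.colLen 0 ≤ N) :
    Matrix.det (Matrix.of fun i j : Fin (lam.colLen 0) => racahCoeff q s N
        (lam.rowLen i + (N - 1 - i)) (mu.rowLen j + (N - 1 - j))) =
      (∏ i : Fin (lam.colLen 0), qPoch q q (lam.rowLen i + (N - 1 - i)) /
        qPoch q q (mu.rowLen i + (N - 1 - i))) * sigmaCoeff q s lam mu := by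
  -- The power of `s₀` is spread over rows and columns, where the entries of `racahCoeff` carry it
  -- as `s₀^{m-n}`; the spurious powers with exponent `N - 1 - i` cancel.
  have hpow : s 0 ^ ((mu.card : ℤ) - lam.card) =
      (∏ i : Fin (lam.colLen 0), (s 0 ^ (lam.rowLen i + (N - 1 - i)))⁻¹) *
        ∏ i : Fin (lam.colLen 0), s 0 ^ (mu.rowLen i + (N - 1 - i)) := by
    rw [← Finset.prod_mul_distrib, zpow_sub₀ hs0, zpow_natCast, zpow_natCast,
      ← sum_rowLen mu (colLen_mono hmu), ← sum_rowLen lam le_rfl, ← Finset.prod_pow_eq_pow_sum,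
      ← Finset.prod_pow_eq_pow_sum, ← Finset.prod_div_distrib]
    refine Finset.prod_congr rfl fun i _ => ?_
    rw [pow_add, pow_add]
    field_simp
  rw [sigmaCoeff, hpow, Finset.prod_div_distrib]
  have hre : ∀ A B C D S : ℂ, A / B * (C * D * S) = (A * C) * ((B⁻¹ * D) * S) := by
    intros
    ring
  rw [hre, ← Finset.prod_mul_distrib, ← Finset.prod_inv_distrib, ← Finset.prod_mul_distrib,
    ← Matrix.det_mul_row, ← Matrix.det_mul_column]
  congr 1
  ext1 i j
  have hi := i.2
  have hj := j.2
  simp only [Matrix.of_apply]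
  rw [racahCoeff]
  -- The shifts `1 - N` and `1 - 2N` in `racahCoeff` cancel the `N` of the shifted parts, so these
  -- exponents no longer depend on `N`.
  have e0 : ((mu.rowLen j + (N - 1 - j) : ℕ) : ℤ) + 1 - N = mu.rowLen j - j := by omega
  have e1 : ((lam.rowLen i + (N - 1 - i) : ℕ) : ℤ) - ((mu.rowLen j + (N - 1 - j) : ℕ) : ℤ) =
      lam.rowLen i - i - mu.rowLen j + j := by omega
  have e2 : ((lam.rowLen i + (N - 1 - i) : ℕ) : ℤ) + ((mu.rowLen j + (N - 1 - j) : ℕ) : ℤ) + 1 -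
      2 * N = (lam.rowLen i : ℤ) + mu.rowLen j - 1 - i - j := by omega
  rw [e0, e1, e2]
  generalize lam.rowLen i + (N - 1 - i) = n at *
  generalize mu.rowLen j + (N - 1 - j) = m at *
  rw [← e1]
  by_cases hmn : m ≤ n
  · obtain ⟨p, rfl⟩ := Nat.exists_eq_add_of_le hmn
    have e3 : ((m + p : ℕ) : ℤ) - (m : ℤ) = p := by omega
    rw [if_pos hmn, if_neg (by omega), e3, Int.toNat_natCast, Nat.add_sub_cancel_left]
    have e4 : (s 0 ^ p)⁻¹ = (s 0 ^ (m + p))⁻¹ * s 0 ^ m := by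
      rw [pow_add]
      field_simp
    rw [e4]
    ring
  · rw [if_neg hmn, if_pos (by omega), mul_zero, mul_zero]

/-- The quotient is a product of `a - b` factors, a number independent of `N`, each tending to `1`.
-/
theorem tendsto_qPoch_ratio {q : ℝ} (hq0 : 0 < q) (hq1 : q < 1) {a b : ℕ} (h : b ≤ a) (i : ℕ) :
    Tendsto (fun N : ℕ => qPoch q q (a + (N - 1 - i)) / qPoch q q (b + (N - 1 - i))) atTop
      (𝓝 1) := by
  have h1 : ∀ N : ℕ, qPoch q q (a + (N - 1 - i)) / qPoch q q (b + (N - 1 - i)) =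
      ∏ k ∈ Finset.range (a - b), (1 - q * (q : ℂ) ^ (b + k) * (q : ℂ) ^ (N - 1 - i)) := by
    intro N
    rw [← qPoch_mul q q (n := a + (N - 1 - i)) (m := b + (N - 1 - i)) (by omega),
      mul_div_cancel_left₀ _ (qPoch_self_ne_zero hq0 hq1 _), qPoch]
    have h2 : a + (N - 1 - i) - (b + (N - 1 - i)) = a - b := by omega
    rw [h2]
    refine Finset.prod_congr rfl fun k _ => ?_
    ring
  simp only [h1]
  have ht : Tendsto (fun N : ℕ => (q : ℂ) ^ (N - 1 - i)) atTop (𝓝 0) := by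
    refine (tendsto_pow_atTop_nhds_zero_of_norm_lt_one (x := (q : ℂ)) ?_).comp
      ((tendsto_sub_atTop_nat i).comp (tendsto_sub_atTop_nat 1))
    rw [Complex.norm_real, Real.norm_of_nonneg hq0.le]
    exact hq1
  have h2 := tendsto_finsetProd (Finset.range (a - b)) fun k _ =>
    (ht.const_mul (q * (q : ℂ) ^ (b + k))).const_sub 1
  simpa using h2

theorem coeff_qRacahSym (q : ℂ) (s : Fin 4 → ℂ) (lam : YoungDiagram) (m : ℕ →₀ ℕ) :
    MvPowerSeries.coeff m (qRacahSym q s lam : MvPowerSeries ℕ ℂ) =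
      ∑ mu ∈ (finite_subdiagrams lam).toFinset, sigmaCoeff q s lam mu *
        MvPowerSeries.coeff m (interpSym q (s 0) mu : MvPowerSeries ℕ ℂ) := by
  rw [qRacahSym, AddSubmonoidClass.coe_finsetSum, map_sum]
  rfl

/-- Termwise limit of the finite expansion: the scalar in front of `I_{μ|N}` tends to `σ(λ, μ)`, and
`I_{μ|N}` converges by (a). -/
theorem convergesTo_qRacahSym {q : ℝ} (hq0 : 0 < q) (hq1 : q < 1) {s : Fin 4 → ℂ} (hs0 : s 0 ≠ 0)
    (hs : ∀ k : ℤ, s 0 * s 1 * s 2 * s 3 ≠ (q : ℂ) ^ k) (lam : YoungDiagram) :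
    ConvergesTo (lam.colLen 0) (renormQRacah q s lam) (qRacahSym q s lam) := by
  refine convergesTo_iff.2 ⟨⟨lam.card, fun N hN => ?_⟩, fun m => ?_⟩
  · rw [renormQRacah_expand hq0 hq1 hs0 hs hN, ← mem_SymPolyLE]
    refine Submodule.sum_mem _ fun mu hmu => Submodule.smul_mem _ _ ?_
    have hmu' : mu ≤ lam := by simpa using hmu
    exact mem_SymPolyLE.2 ((mem_SymPolyLE.1 (interpPoly_mem _ _ ((colLen_mono hmu').trans hN))).trans
      (card_mono hmu'))
  · rw [coeff_qRacahSym]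
    refine (tendsto_finsetSum _ fun mu hmu => ?_).congr' (f₁ := fun N =>
      ∑ mu ∈ (finite_subdiagrams lam).toFinset,
        (∏ i : Fin (lam.colLen 0), qPoch q q (lam.rowLen i + (N - 1 - i)) /
          qPoch q q (mu.rowLen i + (N - 1 - i))) * sigmaCoeff q s lam mu *
        MvPolynomial.coeff (truncExp N m)
          (interpPoly q (s 0) mu N : MvPolynomial (Fin N) ℂ)) ?_
    · have hmu' : mu ≤ lam := by simpa using hmu
      have h1 := tendsto_finsetProd (Finset.univ : Finset (Fin (lam.colLen 0))) fun i _ =>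
        tendsto_qPoch_ratio hq0 hq1 (le_iff_rowLen_le.1 hmu' i) i
      rw [Finset.prod_const_one] at h1
      have h2 := (h1.mul_const (sigmaCoeff q s lam mu)).mul
        ((convergesTo_iff.1 (convergesTo_interpSym hq0 hq1 (s 0) mu)).2 m)
      rwa [one_mul] at h2
    · filter_upwards [eventually_ge_atTop (lam.colLen 0)] with N hN
      rw [renormQRacah_expand hq0 hq1 hs0 hs hN, coeff_sum_smul]
      refine Finset.sum_congr rfl fun mu hmu => ?_
      rw [det_racahCoeff s hs0 (by simpa using hmu) hN]

end QRacah

end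

open QRacah in
theorem mainTheorem3 (q : ℝ) (hq0 : 0 < q) (hq1 : q < 1) (s : Fin 4 → ℂ) (hs0 : s 0 ≠ 0)
    (hs : ∀ k : ℤ, s 0 * s 1 * s 2 * s 3 ≠ (q : ℂ) ^ k) :
    (∀ mu : YoungDiagram,
      ConvergesTo (mu.colLen 0) (interpPoly q (s 0) mu) (interpSym q (s 0) mu)) ∧
    ∀ lam : YoungDiagram,
      ConvergesTo (lam.colLen 0) (renormQRacah q s lam) (qRacahSym q s lam) :=
  ⟨fun mu => convergesTo_interpSym hq0 hq1 (s 0) mu,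
    fun lam => convergesTo_qRacahSym hq0 hq1 hs0 hs lam⟩
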